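/- **Setting.** Let $X_1,X_2,\dots$ be i.i.d. random variables on a probability space $(\Omega,\mathcal T,\mathbb P)$ with law $P$ on a measurable space $\mathcal X$, and let $\mathbb P_n(f)=\frac1n\sum_{i=1}^n f(X_i)$. Let $N\ge 0$ and, for $1\le k\le N$, let $\mathcal A^{(k)}=\{A^{(k)}_1,\dots,A^{(k)}_{m_k}\}$ be a finite measurable partition of $\mathcal X$ with $P(A^{(k)}_j)>0$ for all $j$. The raking-ratio empirical measure is defined by $\mathbb P_n^{(0)}=\mathbb P_n$ and, for $1\le k\le N$, $$\mathbb P_n^{(k)}(f)=\sum_{j=1}^{m_k}\frac{P(A_j^{(k)})}{\mathbb P_n^{(k-1)}(A_j^{(k)})}\,\mathbb P_n^{(k-1)}(f\mathbf 1_{A_j^{(k)}}),$$ where $Q(A)=Q(\mathbf 1_A)$ and a quotient with zero denominator is read as $0$. For $1\le k\le N$ and $n\ge1$ let $n_k=n_k(n)>n$ be integers and let $\mathbb P'_k[\mathcal A^{(k)}]=(\mathbb P'_k(A^{(k)}_1),\dots,\mathbb P'_k(A^{(k)}_{m_k}))$ (depending on $n$) be the random vector of frequencies (counts divided by $n_k$)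 of a multinomial experiment with $n_k$ trials and event probabilities $P(A^{(k)}_1),\dots,P(A^{(k)}_{m_k})$; these vectors need not be independent of each other or of the sample. Let $\widetilde{\mathbb P}_n^{(k)}$ be defined by the same recursion with $\mathbb P'_k(A_j^{(k)})$ in place of $P(A_j^{(k)})$, starting from $\widetilde{\mathbb P}_n^{(0)}=\mathbb P_n$. Put $n_{(N)}=\min_{1\le k\le N}n_k$ (for $N\ge1$). Let $\mathcal B=\{B_1,\dots,B_m\}$, $m\ge2$, be a measurable partition of $\mathcal X$ and $P_0$ a probability measure on $\mathcal X$ with $P_0(B_i)>0$ for all $i$. Let $$T_n=n\sum_{i=1}^m\frac{(\mathbb P_n(B_i)-P_0(B_i))^2}{P_0(B_i)},\quad T_n^{(N)}=n\sum_{i=1}^m\frac{(\mathbb P_n^{(N)}(B_i)-P_0(B_i))^2}{P_0(B_i)},\quad \widetilde T_n^{(N)}=n\sum_{i=1}^m\frac{(\widetilde{\mathbb P}_n^{(N)}(B_i)-P_0(B_i))^2}{P_0(B_i)},$$ and, for $\alpha\in(0,1)$, let $t_\alpha^{(m)}$ be the $(1-\alpha)$-quantile of the $\chi^2$ distribution with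 $m-1$ degrees of freedom. **Proposition.** (i) Suppose $(H_0)$: $P(B_i)=P_0(B_i)$ for all $i$. Then for all $\alpha\in(0,1)$ the following limits exist and satisfy $$\lim_{n\to\infty}\mathbb P(T_n^{(N)}>t_\alpha^{(m)})\le\lim_{n\to\infty}\mathbb P(T_n>t_\alpha^{(m)})=\alpha .$$ If moreover $N\ge1$ and $n\log n=o(n_{(N)})$, then the following limit exists and satisfies $$\lim_{n\to\infty}\mathbb P(\widetilde T_n^{(N)}>t_\alpha^{(m)})\le\alpha .$$ (ii) Suppose $(H_1)$: $P(B_i)\ne P_0(B_i)$ for some $i$. Then for all $\alpha\in(0,1)$, almost surely there exists $n_0$ such that for all $n>n_0$, $$\min\big(|T_n|,|T_n^{(N)}|,|\widetilde T_n^{(N)}|\big)>t_\alpha^{(m)} .$$ -/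

import Mathlib

open MeasureTheory ProbabilityTheory Filter Topology Asymptotics

noncomputable section

namespace RakingRatio

/-- A finite measurable partition of `𝒳` into the sets `A 0, …, A (m - 1)`. -/
structure IsMeasurablePartition {𝒳 : Type*} [MeasurableSpace 𝒳] {m : ℕ}
    (A : Fin m → Set 𝒳) : Prop where
  measurableSet : ∀ j, MeasurableSet (A j)
  pairwise_disjoint : Pairwise fun i j => Disjoint (A i) (A j)
  iUnion_eq : ⋃ j, A j = Set.univ

/-- The empirical measure `ℙₙ(f) = (1/n) ∑_{i ≤ n} f(xᵢ)` of the first `n` points of a sample. -/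
def empirical {𝒳 : Type*} (x : ℕ → 𝒳) (n : ℕ) (f : 𝒳 → ℝ) : ℝ :=
  (∑ i ∈ Finset.range n, f (x i)) / n

/-- The raking-ratio empirical measure after `N` steps, the `k`-th step (`k = 1, …, N`) using the
partition `A k` and the weights `p k` as (true or learned) probabilities of its sets. -/
def raked {𝒳 : Type*} {mA : ℕ → ℕ} (A : (k : ℕ) → Fin (mA k) → Set 𝒳)
    (p : (k : ℕ) → Fin (mA k) → ℝ) (x : ℕ → 𝒳) (n : ℕ) : ℕ → (𝒳 → ℝ) → ℝ
  | 0, f => empirical x n f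
  | N + 1, f =>
      ∑ j, p (N + 1) j / raked A p x n N ((A (N + 1) j).indicator 1) *
        raked A p x n N ((A (N + 1) j).indicator f)

/-- The law of one trial with outcome `j` of probability `p j`. -/
def categorical {m : ℕ} (p : Fin m → ℝ) : Measure (Fin m) :=
  ∑ j, ENNReal.ofReal (p j) • Measure.dirac j

/-- The multinomial law: the numbers of occurrences of the outcomes in `n` independent trials
with event probabilities `p`. -/
def multinomial {m : ℕ} (n : ℕ) (p : Fin m → ℝ) : Measure (Fin m → ℕ) :=
  (Measure.pi fun _ : Fin n => categorical p).map
    fun y j => (Finset.univ.filter fun i => y i = j).card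

/-- The law of the vector of observed frequencies of a multinomial experiment with `n` trials. -/
def multinomialFreq {m : ℕ} (n : ℕ) (p : Fin m → ℝ) : Measure (Fin m → ℝ) :=
  (multinomial n p).map fun c j => (c j : ℝ) / n

/-- The smallest of the sizes of the sources `1, …, N` (meaningful for `N ≥ 1`), where
`size k n` is the size of the `k`-th source when the main sample has size `n`. -/
def minSize (size : ℕ → ℕ → ℕ) (N n : ℕ) : ℕ :=
  sInf ((fun k => size k n) '' Set.Icc 1 N)

/-- The `χ²` law with `d` degrees of freedom. -/
def chiSquare (d : ℕ) : Measure ℝ :=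
  (Measure.pi fun _ : Fin d => gaussianReal 0 1).map fun z => ∑ i, z i ^ 2

/-- The quantile function of a law on `ℝ`. -/
def quantile (ν : Measure ℝ) (u : ℝ) : ℝ :=
  sInf {t : ℝ | u ≤ cdf ν t}

/-- The critical value at level `α` of the chi-square test on `m` cells, i.e. the
`1 - α` quantile of `χ²(m - 1)`. -/
def critical (m : ℕ) (α : ℝ) : ℝ :=
  quantile (chiSquare (m - 1)) (1 - α)

/-- The chi-square statistic `n ∑ᵢ (Q(Bᵢ) - P₀(Bᵢ))² / P₀(Bᵢ)` of an estimate `Q` of the law. -/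
def chiStat {𝒳 : Type*} [MeasurableSpace 𝒳] {m : ℕ} (B : Fin m → Set 𝒳) (P₀ : Measure 𝒳)
    (n : ℕ) (Q : (𝒳 → ℝ) → ℝ) : ℝ :=
  n * ∑ i, (Q ((B i).indicator 1) - P₀.real (B i)) ^ 2 / P₀.real (B i)

/-- The usual chi-square statistic `Tₙ`. -/
def stat {Ω 𝒳 : Type*} [MeasurableSpace 𝒳] {m : ℕ} (B : Fin m → Set 𝒳) (P₀ : Measure 𝒳)
    (X : ℕ → Ω → 𝒳) (n : ℕ) (ω : Ω) : ℝ :=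
  chiStat B P₀ n (empirical (fun i => X i ω) n)

/-- The statistic `Tₙ⁽ᴺ⁾`, raked with the true probabilities of the sets of `A 1, …, A N`. -/
def statTrue {Ω 𝒳 : Type*} [MeasurableSpace 𝒳] {m : ℕ} (B : Fin m → Set 𝒳) (P₀ P : Measure 𝒳)
    {mA : ℕ → ℕ} (A : (k : ℕ) → Fin (mA k) → Set 𝒳) (X : ℕ → Ω → 𝒳) (N n : ℕ) (ω : Ω) : ℝ :=
  chiStat B P₀ n (raked A (fun k j => P.real (A k j)) (fun i => X i ω) n N)

/-- The statistic `T̃ₙ⁽ᴺ⁾`, raked with learned probabilities; `learned k n ω` is the estimate of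
the probabilities of the sets of `A k` used when the main sample has size `n`. -/
def statLearned {Ω 𝒳 : Type*} [MeasurableSpace 𝒳] {m : ℕ} (B : Fin m → Set 𝒳) (P₀ : Measure 𝒳)
    {mA : ℕ → ℕ} (A : (k : ℕ) → Fin (mA k) → Set 𝒳)
    (learned : (k : ℕ) → ℕ → Ω → Fin (mA k) → ℝ) (X : ℕ → Ω → 𝒳) (N n : ℕ) (ω : Ω) : ℝ :=
  chiStat B P₀ n (raked A (fun k => learned k n ω) (fun i => X i ω) n N)

end RakingRatio

end

/-! To first order, raking on a partition replaces a function by the function minus its conditional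
expectation given that partition. If the weights used at each step are within o(n^{-1/2}) of the
true cell probabilities in probability, then √n(ℙₙ⁽ᴺ⁾(f) - P(f)) differs by o_P(1) from the same
quantity for ℙₙ and the iterated centering of f (`isNegligible_raked_sub_empirical`). The
multivariate central limit theorem and Slutsky's lemma then make the chi-square statistic converge
in law to xᵀSx, with x standard Gaussian and S the covariance matrix of the centered, normalized
cell indicators (`tendsto_measureReal_lt_chiStat_raked`).

The form xᵀSx is the variance of a single function depending linearly on x. Conditional centering is
linear and does not increase variance, so the raked form is at most the unraked one for every x.
Both live on the same Gaussian space, hence the tail events are nested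
(`dotProduct_covMatrix_rakedScore_le`). Without raking S = I - uuᵀ with u = (√P(Bᵢ)) a unit vector,
which gives χ²(m - 1) and the level α. Although S may be singular, the tails converge at the
critical value because it is positive and positive level sets of a Gaussian seminorm are null.

For learned weights, Hoeffding's inequality gives the o(n^{-1/2}) rate once size/n → ∞. Under the
alternative, the strong law, together with Borel–Cantelli for the learned weights, makes all three
estimates consistent, so each statistic grows at least linearly in n. -/

noncomputable section

namespace RakingRatio

/-! ### Gaussian null sets, the chi-square law and its critical values -/

lemma pi_absolutelyContinuous {d : ℕ} {γ ν : Measure ℝ} [SigmaFinite γ] [SigmaFinite ν]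
    (h : γ ≪ ν) :
    (Measure.pi fun _ : Fin d => γ) ≪ Measure.pi fun _ : Fin d => ν := by
  induction d with
  | zero =>
    rw [Measure.pi_of_empty, Measure.pi_of_empty]
  | succ d ih =>
    have h1 := (measurePreserving_piFinSuccAbove (fun _ : Fin (d + 1) => γ) 0).symm
    have h2 := (measurePreserving_piFinSuccAbove (fun _ : Fin (d + 1) => ν) 0).symm
    rw [← h1.map_eq, ← h2.map_eq]
    exact (h.prod ih).map h1.measurable

lemma stdGaussian_absolutelyContinuous (d : ℕ) :
    stdGaussian (EuclideanSpace ℝ (Fin d)) ≪ volume := by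
  rw [← map_pi_eq_stdGaussian, ← (PiLp.volume_preserving_toLp (Fin d)).map_eq]
  exact (pi_absolutelyContinuous (gaussianReal_absolutelyContinuous 0 one_ne_zero)).map
    (by fun_prop)

/-- The level sets at a positive level of a seminorm coming from a linear map are null. -/
lemma stdGaussian_norm_eq_null {d : ℕ} {F : Type*} [NormedAddCommGroup F] [NormedSpace ℝ F]
    (L : EuclideanSpace ℝ (Fin d) →L[ℝ] F) {s : ℝ} (hs : 0 < s) :
    stdGaussian (EuclideanSpace ℝ (Fin d)) {x | ‖L x‖ = s} = 0 := by
  apply stdGaussian_absolutelyContinuous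
  -- The frontier of a convex set is Lebesgue null, which also covers a non-injective `L`.
  have hconv : Convex ℝ {x | ‖L x‖ ≤ s} := by
    have := (convex_closedBall (0 : F) s).linear_preimage L.toLinearMap
    simpa [Set.preimage, Metric.mem_closedBall] using this
  refine measure_mono_null (fun x hx => ?_) (hconv.addHaar_frontier volume)
  have hx' : ‖L x‖ = s := hx
  refine ⟨subset_closure hx'.le, fun hint => ?_⟩
  -- Dilating by c > 1 pushes a point of the level set out of the sublevel set, since s > 0; such a
  -- point is therefore not interior.
  have hlim : Tendsto (fun c : ℝ => c • x) (𝓝[>] 1) (𝓝 x) := by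
    have : Tendsto (fun c : ℝ => c • x) (𝓝 1) (𝓝 ((1 : ℝ) • x)) :=
      (continuous_id.smul continuous_const).tendsto 1
    rw [one_smul] at this
    exact this.mono_left nhdsWithin_le_nhds
  have hev : ∀ᶠ c : ℝ in 𝓝[>] 1, c • x ∈ {x | ‖L x‖ ≤ s} :=
    hlim (mem_interior_iff_mem_nhds.1 hint)
  obtain ⟨c, hc, hc1⟩ := ((hev.and self_mem_nhdsWithin).exists)
  have hc1 : 1 < c := hc1
  have hc : ‖L (c • x)‖ ≤ s := hc
  rw [map_smul, norm_smul, hx', Real.norm_eq_abs, abs_of_pos (by linarith)] at hc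
  nlinarith

instance (d : ℕ) : IsProbabilityMeasure (chiSquare d) :=
  Measure.isProbabilityMeasure_map (Measurable.aemeasurable (by fun_prop))

lemma chiSquare_eq_map_stdGaussian (d : ℕ) :
    chiSquare d = (stdGaussian (EuclideanSpace ℝ (Fin d))).map fun x => ‖x‖ ^ 2 := by
  rw [← map_pi_eq_stdGaussian, Measure.map_map (by fun_prop) (by fun_prop), chiSquare]
  congr 1
  ext z
  simp [EuclideanSpace.real_norm_sq_eq]

lemma chiSquare_Iic_zero {d : ℕ} (hd : 0 < d) : chiSquare d (Set.Iic 0) = 0 := by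
  rw [chiSquare_eq_map_stdGaussian, Measure.map_apply (by fun_prop) measurableSet_Iic]
  have : (fun x : EuclideanSpace ℝ (Fin d) => ‖x‖ ^ 2) ⁻¹' Set.Iic 0 = {0} := by
    ext x
    simp only [Set.mem_preimage, Set.mem_Iic, Set.mem_singleton_iff]
    rw [← norm_eq_zero]
    constructor
    · intro h; nlinarith [sq_nonneg ‖x‖]
    · intro h; simp [h]
  rw [this]
  apply stdGaussian_absolutelyContinuous
  have : Nonempty (Fin d) := ⟨⟨0, hd⟩⟩
  exact measure_singleton 0

lemma chiSquare_singleton {d : ℕ} (hd : 0 < d) (t : ℝ) : chiSquare d {t} = 0 := by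
  rcases le_or_gt t 0 with ht | ht
  · exact measure_mono_null (by simpa using ht) (chiSquare_Iic_zero hd)
  rw [chiSquare_eq_map_stdGaussian, Measure.map_apply (by fun_prop) (measurableSet_singleton t)]
  refine measure_mono_null (fun x hx => ?_)
    (stdGaussian_norm_eq_null (ContinuousLinearMap.id ℝ _) (Real.sqrt_pos.2 ht))
  have hx : ‖x‖ ^ 2 = t := hx
  simp [← hx]

lemma continuous_cdf_chiSquare {d : ℕ} (hd : 0 < d) : Continuous (cdf (chiSquare d)) := by
  rw [continuous_iff_continuousAt]
  intro t
  have := (cdf (chiSquare d)).measure_singleton t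
  rw [measure_cdf, chiSquare_singleton hd, eq_comm, ENNReal.ofReal_eq_zero, sub_nonpos] at this
  have hle := (monotone_cdf (chiSquare d)).leftLim_le (le_refl t)
  rw [(monotone_cdf (chiSquare d)).continuousAt_iff_leftLim_eq_rightLim,
    le_antisymm hle this, (cdf (chiSquare d)).rightLim_eq]

/-- Continuity makes the superlevel set closed, so its infimum is attained; approaching the infimum
from the left gives the reverse inequality. -/
lemma cdf_quantile {ν : Measure ℝ} [IsProbabilityMeasure ν] (hc : Continuous (cdf ν)) {u : ℝ}
    (hu0 : 0 < u) (hu1 : u < 1) : cdf ν (quantile ν u) = u := by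
  obtain ⟨a, ha⟩ := ((tendsto_cdf_atBot ν).eventually (gt_mem_nhds hu0)).exists
  obtain ⟨b, hb⟩ := ((tendsto_cdf_atTop ν).eventually (lt_mem_nhds hu1)).exists
  have hbdd : BddBelow {t : ℝ | u ≤ cdf ν t} := by
    refine ⟨a, fun t ht => ?_⟩
    by_contra! h
    exact absurd (ht.trans (monotone_cdf ν h.le)) (not_le.2 ha)
  have hne : {t : ℝ | u ≤ cdf ν t}.Nonempty := ⟨b, hb.le⟩
  have hclosed : IsClosed {t : ℝ | u ≤ cdf ν t} := isClosed_le continuous_const hc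
  have hge : u ≤ cdf ν (quantile ν u) := hclosed.csInf_mem hne hbdd
  refine le_antisymm ?_ hge
  have hlim : Tendsto (cdf ν) (𝓝[<] quantile ν u) (𝓝 (cdf ν (quantile ν u))) :=
    (hc.tendsto _).mono_left nhdsWithin_le_nhds
  refine le_of_tendsto hlim (eventually_nhdsWithin_of_forall fun t ht => ?_)
  by_contra! h
  exact absurd (csInf_le hbdd (show t ∈ {t : ℝ | u ≤ cdf ν t} from h.le)) (not_le.2 ht)

lemma chiSquare_Ioi_critical {m : ℕ} (hm : 2 ≤ m) {α : ℝ} (h0 : 0 < α) (h1 : α < 1) :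
    (chiSquare (m - 1)).real (Set.Ioi (critical m α)) = α := by
  have h := cdf_quantile (continuous_cdf_chiSquare (d := m - 1) (by omega))
    (u := 1 - α) (by linarith) (by linarith)
  rw [cdf_eq_real] at h
  rw [← Set.compl_Iic, probReal_compl_eq_one_sub measurableSet_Iic, critical, h]
  ring

/-- Positivity is what allows the limiting form to be degenerate: its law may have an atom at 0, but
nowhere above. -/
lemma critical_pos {m : ℕ} (hm : 2 ≤ m) {α : ℝ} (h1 : α < 1) (h0 : 0 < α) :
    0 < critical m α := by
  by_contra! h
  have hq := cdf_quantile (continuous_cdf_chiSquare (d := m - 1) (by omega))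
    (u := 1 - α) (by linarith) (by linarith)
  have := monotone_cdf (chiSquare (m - 1)) h
  rw [critical, hq, cdf_eq_real, measureReal_def, chiSquare_Iic_zero (by omega)] at this
  simp at this
  linarith

/-- The squared distance of a standard Gaussian vector to a line is a `χ²` variable. -/
lemma map_norm_sq_sub_inner_sq {d : ℕ} (u : EuclideanSpace ℝ (Fin (d + 1))) (hu : ‖u‖ = 1) :
    (stdGaussian (EuclideanSpace ℝ (Fin (d + 1)))).map (fun x => ‖x‖ ^ 2 - (inner ℝ u x) ^ 2) =
      chiSquare d := by
  -- Only the value at index 0 of the constant family is prescribed, so the basis starts with `u`.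
  -- In its coordinates the Gaussian is still a product, and the first square cancels.
  obtain ⟨b, hb⟩ := Orthonormal.exists_orthonormalBasis_extension_of_card_eq (𝕜 := ℝ)
    (E := EuclideanSpace ℝ (Fin (d + 1))) (ι := Fin (d + 1)) (by simp)
    (v := fun _ => u) (s := {0}) (by
      constructor
      · intro i; simpa using hu
      · intro i j hij; exact absurd (Subsingleton.elim i j) hij)
  have hb0 : b 0 = u := hb 0 (by simp)
  rw [stdGaussian_eq_map_pi_orthonormalBasis b, Measure.map_map (by fun_prop) (by fun_prop),
    chiSquare]
  have hfun : (fun x : EuclideanSpace ℝ (Fin (d + 1)) => ‖x‖ ^ 2 - (inner ℝ u x) ^ 2) ∘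
      (fun x : Fin (d + 1) → ℝ => ∑ i, x i • b i) =
      (fun z : Fin d → ℝ => ∑ i, z i ^ 2) ∘ Prod.snd ∘
        (MeasurableEquiv.piFinSuccAbove (fun _ => ℝ) 0) := by
    ext x
    have h1 : ‖∑ i, x i • b i‖ ^ 2 = ∑ i, x i ^ 2 := by
      rw [← b.sum_sq_inner_right]
      refine Finset.sum_congr rfl fun i _ => ?_
      rw [b.orthonormal.inner_right_fintype]
    have h2 : inner ℝ u (∑ i, x i • b i) = x 0 := by
      rw [← hb0, b.orthonormal.inner_right_fintype]
    simp only [Function.comp_apply, h1, h2]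
    rw [Fin.sum_univ_succ, add_sub_cancel_left]
    simp [Fin.tail]
  rw [hfun, ← Measure.map_map (by fun_prop) (by fun_prop),
    ← Measure.map_map (by fun_prop) (by fun_prop),
    (measurePreserving_piFinSuccAbove (fun _ : Fin (d + 1) => gaussianReal 0 1) 0).map_eq,
    ← Measure.snd, Measure.snd_prod]

/-! ### Covariance matrices and the multivariate central limit theorem -/

section

open scoped RealInnerProductSpace MatrixOrder

/-- The covariance matrix of finitely many functions under `P`. -/
def covMatrix {𝒳 : Type*} [MeasurableSpace 𝒳] (P : Measure 𝒳) {m : ℕ} (g : Fin m → 𝒳 → ℝ) :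
    Matrix (Fin m) (Fin m) ℝ :=
  Matrix.of fun i j => cov[g i, g j; P]

section CovMatrix

variable {𝒳 : Type*} [MeasurableSpace 𝒳] {P : Measure 𝒳} [IsProbabilityMeasure P] {m : ℕ}
  {g : Fin m → 𝒳 → ℝ}

/-- Reading the form as a variance gives positive semidefiniteness, the characteristic function in
the limit theorem and the comparison of raked with unraked forms. -/
lemma dotProduct_covMatrix_mulVec (hg : ∀ i, MemLp (g i) 2 P) (t : Fin m → ℝ) :
    t ⬝ᵥ (covMatrix P g).mulVec t = Var[fun x => ∑ i, t i * g i x; P] := by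
  rw [variance_fun_sum fun i => (hg i).const_mul (t i)]
  simp only [dotProduct, Matrix.mulVec, covMatrix, Matrix.of_apply, Finset.mul_sum,
    covariance_const_mul_left, covariance_const_mul_right]
  exact Finset.sum_congr rfl fun i _ => Finset.sum_congr rfl fun j _ => by ring

lemma posSemidef_covMatrix (hg : ∀ i, MemLp (g i) 2 P) : (covMatrix P g).PosSemidef := by
  refine Matrix.PosSemidef.of_dotProduct_mulVec_nonneg ?_ fun t => ?_
  · ext i j
    simp [covMatrix, covariance_comm]
  · rw [star_trivial, dotProduct_covMatrix_mulVec hg]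
    exact variance_nonneg _ _

end CovMatrix

/-- The square root is self-adjoint and squares to `S`. It expresses Gaussian limits with different
covariances through one standard Gaussian vector. -/
lemma norm_toEuclideanCLM_sqrt_sq {m : ℕ} {S : Matrix (Fin m) (Fin m) ℝ} (hS : S.PosSemidef)
    (x : EuclideanSpace ℝ (Fin m)) :
    ‖Matrix.toEuclideanCLM (𝕜 := ℝ) (CFC.sqrt S) x‖ ^ 2 = x.ofLp ⬝ᵥ S.mulVec x.ofLp := by
  have hsa : IsSelfAdjoint (Matrix.toEuclideanCLM (𝕜 := ℝ) (CFC.sqrt S)) :=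
    (CFC.sqrt_nonneg S).isSelfAdjoint.map _
  have hsq : CFC.sqrt S * CFC.sqrt S = S := CFC.sqrt_mul_sqrt_self _ hS.nonneg
  rw [← real_inner_self_eq_norm_sq, ← ContinuousLinearMap.adjoint_inner_right,
    hsa.adjoint_eq, ← ContinuousLinearMap.comp_apply, ← ContinuousLinearMap.mul_def, ← map_mul,
    hsq, Matrix.inner_toEuclideanCLM]

/-- The normalized empirical vector `√n (ℙₙ(gᵢ) - P(gᵢ))ᵢ`. -/
def empVector {Ω 𝒳 : Type*} [MeasurableSpace 𝒳] (P : Measure 𝒳) (X : ℕ → Ω → 𝒳) {m : ℕ}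
    (g : Fin m → 𝒳 → ℝ) (n : ℕ) (ω : Ω) : EuclideanSpace ℝ (Fin m) :=
  WithLp.toLp 2 fun i => √n * (empirical (fun i => X i ω) n (g i) - ∫ x, g i x ∂P)

lemma sqrt_mul_empirical_sub {𝒳 : Type*} (x : ℕ → 𝒳) (n : ℕ) (f : 𝒳 → ℝ) (a : ℝ) :
    √n * (empirical x n f - a) = (√n)⁻¹ * (∑ k ∈ Finset.range n, f (x k) - n * a) := by
  rcases Nat.eq_zero_or_pos n with rfl | hn
  · simp
  have h : (0 : ℝ) < n := by exact_mod_cast hn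
  have h' := Real.sqrt_pos.2 h
  rw [empirical]
  field_simp
  rw [Real.sq_sqrt h.le]

section CLT

variable {Ω 𝒳 : Type*} [MeasurableSpace Ω] [MeasurableSpace 𝒳] {μ : Measure Ω}
  {P : Measure 𝒳} {X : ℕ → Ω → 𝒳}

lemma aemeasurable_empirical (hX_law : ∀ i, HasLaw (X i) P μ) {f : 𝒳 → ℝ} (hf : Measurable f)
    (n : ℕ) : AEMeasurable (fun ω => empirical (fun i => X i ω) n f) μ := by
  unfold empirical
  refine AEMeasurable.div_const (Finset.aemeasurable_fun_sum _ fun i _ => ?_) _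
  exact hf.comp_aemeasurable (hX_law i).aemeasurable

lemma aemeasurable_empVector (hX_law : ∀ i, HasLaw (X i) P μ) {m : ℕ} {g : Fin m → 𝒳 → ℝ}
    (hgm : ∀ i, Measurable (g i)) (n : ℕ) : AEMeasurable (empVector P X g n) μ := by
  refine (WithLp.measurable_toLp 2 _).comp_aemeasurable (aemeasurable_pi_lambda _ fun i => ?_)
  exact ((aemeasurable_empirical hX_law (hgm i) n).sub_const _).const_mul _

variable [IsProbabilityMeasure μ] [IsProbabilityMeasure P]

/-- The multivariate central limit theorem for empirical measures. -/
theorem tendstoInDistribution_empVector (hX_indep : iIndepFun X μ)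
    (hX_law : ∀ i, HasLaw (X i) P μ) {m : ℕ} {g : Fin m → 𝒳 → ℝ} (hgm : ∀ i, Measurable (g i))
    (hg : ∀ i, MemLp (g i) 2 P) :
    TendstoInDistribution (empVector P X g) atTop id (fun _ => μ)
      (multivariateGaussian 0 (covMatrix P g)) where
  forall_aemeasurable n := aemeasurable_empVector hX_law hgm n
  aemeasurable_limit := aemeasurable_id
  tendsto := by
    have hmeas := aemeasurable_empVector hX_law hgm
    refine ProbabilityMeasure.tendsto_iff_tendsto_charFun.2 fun t => ?_
    simp only [ProbabilityMeasure.coe_mk, Measure.map_id]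
    rw [charFun_multivariateGaussian (posSemidef_covMatrix hg), dotProduct_covMatrix_mulVec hg]
    -- Cramér–Wold: the characteristic function of the vector at `t` is that of the normalized sum
    -- of `f` at 1.
    set f : 𝒳 → ℝ := fun x => ∑ i, t i * g i x with hf
    have hfm : Measurable f := by fun_prop
    have hfL : MemLp f 2 P := memLp_finsetSum _ fun i _ => (hg i).const_mul (t i)
    have hfi : ∫ x, f x ∂P = ∑ i, t i * ∫ x, g i x ∂P := by
      rw [hf, integral_finsetSum _ fun i _ => ((hg i).integrable (by simp)).const_mul (t i)]
      simp_rw [integral_const_mul]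
    have hlaw : ∀ i, HasLaw (fun ω => f (X i ω)) (P.map f) μ := fun i =>
      HasLaw.comp (X := X i) (Y := f) ⟨hfm.aemeasurable, rfl⟩ (hX_law i)
    have hvar : Var[fun ω => f (X 0 ω); μ] = Var[f; P] := by
      rw [← (hX_law 0).map_eq, variance_map (by fun_prop) (hX_law 0).aemeasurable]
      rfl
    have hmean : ∫ ω, f (X 0 ω) ∂μ = ∫ x, f x ∂P := by
      rw [← (hX_law 0).map_eq, integral_map (hX_law 0).aemeasurable (by fun_prop)]
    have hclt := tendstoInDistribution_inv_sqrt_mul_sum_sub (X := fun i ω => f (X i ω)) (P := μ)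
      (Y := id) (P' := gaussianReal 0 Var[fun ω => f (X 0 ω); μ].toNNReal)
      ⟨aemeasurable_id, Measure.map_id⟩
      (by
        have := (hX_law 0).map_eq ▸ hfL
        exact this.comp_of_map (hX_law 0).aemeasurable)
      (hX_indep.comp (fun _ => f) fun _ => hfm)
      (fun i => ⟨(hlaw i).aemeasurable, (hlaw 0).aemeasurable,
        (hlaw i).map_eq.trans (hlaw 0).map_eq.symm⟩)
    have h1 := ProbabilityMeasure.tendsto_iff_tendsto_charFun.1 hclt.tendsto 1
    simp only [ProbabilityMeasure.coe_mk, Measure.map_id, charFun_gaussianReal] at h1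
    rw [hvar, hmean] at h1
    convert h1 using 2 with n
    · rw [charFun_apply, charFun_apply_real, integral_map (hmeas n) (by fun_prop),
        integral_map (hmean ▸ hclt.forall_aemeasurable n) (by fun_prop)]
      congr 1
      ext ω
      rw [← sqrt_mul_empirical_sub]
      congr 3
      rw [hfi]
      simp only [PiLp.inner_apply, empVector, hf, empirical]
      simp only [Complex.ofReal_one, one_mul, RCLike.inner_apply, conj_trivial]
      norm_cast
      rw [Finset.sum_comm, Finset.sum_div, ← Finset.sum_sub_distrib, Finset.mul_sum]
      refine Finset.sum_congr rfl fun i _ => ?_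
      rw [← Finset.mul_sum]
      ring
    · simp [variance_nonneg]

/-- The squared norm of a sequence with a Gaussian limit has converging tails. -/
theorem tendsto_measureReal_lt_norm_sq {m : ℕ} {S : Matrix (Fin m) (Fin m) ℝ}
    (hS : S.PosSemidef) {W : ℕ → Ω → EuclideanSpace ℝ (Fin m)}
    (hW : TendstoInDistribution W atTop id (fun _ => μ) (multivariateGaussian 0 S))
    {c : ℝ} (hc : 0 < c) :
    Tendsto (fun n => μ.real {ω | c < ‖W n ω‖ ^ 2}) atTop
      (𝓝 ((stdGaussian (EuclideanSpace ℝ (Fin m))).real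
        {x | c < x.ofLp ⬝ᵥ S.mulVec x.ofLp})) := by
  have hmap : multivariateGaussian 0 S = (stdGaussian (EuclideanSpace ℝ (Fin m))).map
      (Matrix.toEuclideanCLM (𝕜 := ℝ) (CFC.sqrt S)) := by
    rw [multivariateGaussian]
    simp
  set E : Set (EuclideanSpace ℝ (Fin m)) := {x | c < ‖x‖ ^ 2} with hE
  have hEm : MeasurableSet E := measurableSet_lt measurable_const (by fun_prop)
  -- Portmanteau needs a null frontier; it lies in a level set at the positive level √c.
  have hfr : (multivariateGaussian 0 S) (frontier E) = 0 := by
    have hsub : frontier E ⊆ {x | c = ‖x‖ ^ 2} :=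
      frontier_lt_subset_eq continuous_const (by fun_prop)
    refine measure_mono_null hsub ?_
    rw [hmap, Measure.map_apply (by fun_prop)
      (measurableSet_eq_fun measurable_const (by fun_prop))]
    refine measure_mono_null (fun x hx => ?_) (stdGaussian_norm_eq_null
      (Matrix.toEuclideanCLM (𝕜 := ℝ) (CFC.sqrt S)) (Real.sqrt_pos.2 hc))
    have hx : c = ‖Matrix.toEuclideanCLM (𝕜 := ℝ) (CFC.sqrt S) x‖ ^ 2 := hx
    simp [hx]
  have key := ProbabilityMeasure.tendsto_measure_of_null_frontier_of_tendsto' hW.tendsto (E := E)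
    (by simpa using hfr)
  simp only [ProbabilityMeasure.coe_mk, Measure.map_id] at key
  have key' := (ENNReal.tendsto_toReal (measure_ne_top _ _)).comp key
  convert key' using 2
  · rename_i n
    simp only [Function.comp_apply]
    rw [Measure.map_apply_of_aemeasurable (hW.forall_aemeasurable n) hEm]
    rfl
  · rw [hmap, Measure.map_apply (by fun_prop) hEm, measureReal_def]
    congr 2
    ext x
    simp only [hE, Set.mem_preimage, Set.mem_ofPred_eq, norm_toEuclideanCLM_sqrt_sq hS]

end CLT

end

/-! ### Bounded measurable functions and linearity of raking -/

/-- Bounded measurable real functions. -/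
def IsBddMeasurable {𝒳 : Type*} [MeasurableSpace 𝒳] (f : 𝒳 → ℝ) : Prop :=
  Measurable f ∧ ∃ C, ∀ x, |f x| ≤ C

namespace IsBddMeasurable

variable {𝒳 : Type*} [MeasurableSpace 𝒳] {f g : 𝒳 → ℝ}

lemma indicator (hf : IsBddMeasurable f) {s : Set 𝒳} (hs : MeasurableSet s) :
    IsBddMeasurable (s.indicator f) := by
  obtain ⟨hm, C, hC⟩ := hf
  refine ⟨hm.indicator hs, C, fun x => ?_⟩
  by_cases hx : x ∈ s
  · simpa [hx] using hC x
  · simpa [hx] using (abs_nonneg _).trans (hC x)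

lemma indicator_one {s : Set 𝒳} (hs : MeasurableSet s) :
    IsBddMeasurable (s.indicator (1 : 𝒳 → ℝ)) :=
  IsBddMeasurable.indicator ⟨measurable_one, 1, by simp⟩ hs

lemma sub (hf : IsBddMeasurable f) (hg : IsBddMeasurable g) : IsBddMeasurable (f - g) := by
  obtain ⟨hm, C, hC⟩ := hf
  obtain ⟨hm', C', hC'⟩ := hg
  exact ⟨hm.sub hm', C + C', fun x => (abs_sub _ _).trans (add_le_add (hC x) (hC' x))⟩

lemma const_smul (hf : IsBddMeasurable f) (c : ℝ) : IsBddMeasurable (c • f) := by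
  obtain ⟨hm, C, hC⟩ := hf
  refine ⟨hm.const_smul c, |c| * C, fun x => ?_⟩
  simpa [abs_mul] using mul_le_mul_of_nonneg_left (hC x) (abs_nonneg c)

lemma sum {ι : Type*} {s : Finset ι} {g : ι → 𝒳 → ℝ} (hg : ∀ i, IsBddMeasurable (g i)) :
    IsBddMeasurable (∑ i ∈ s, g i) := by
  choose hm C hC using hg
  refine ⟨by fun_prop, ∑ i ∈ s, C i, fun x => ?_⟩
  rw [Finset.sum_apply]
  exact (Finset.abs_sum_le_sum_abs _ _).trans (Finset.sum_le_sum fun i _ => hC i x)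

lemma memLp (hf : IsBddMeasurable f) (P : Measure 𝒳) [IsFiniteMeasure P] (p : ENNReal) :
    MemLp f p P := by
  obtain ⟨hm, C, hC⟩ := hf
  exact MemLp.of_bound hm.aestronglyMeasurable C (ae_of_all _ hC)

lemma integrable (hf : IsBddMeasurable f) (P : Measure 𝒳) [IsFiniteMeasure P] :
    Integrable f P :=
  memLp_one_iff_integrable.1 (hf.memLp P 1)

end IsBddMeasurable

lemma isLinearMap_raked {𝒳 : Type*} {mA : ℕ → ℕ} (A : (k : ℕ) → Fin (mA k) → Set 𝒳)
    (p : (k : ℕ) → Fin (mA k) → ℝ) (x : ℕ → 𝒳) (n N : ℕ) :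
    IsLinearMap ℝ (raked A p x n N) := by
  induction N with
  | zero =>
    constructor
    · intro f g
      simp [raked, empirical, Finset.sum_add_distrib, add_div]
    · intro c f
      simp [raked, empirical, ← Finset.mul_sum, mul_div_assoc]
  | succ N ih =>
    constructor
    · intro f g
      simp only [raked, Set.indicator_add', ih.map_add, mul_add, Finset.sum_add_distrib]
    · intro c f
      simp only [raked, smul_eq_mul, Finset.mul_sum]
      refine Finset.sum_congr rfl fun j _ => ?_
      have : (A (N + 1) j).indicator (c • f) = c • (A (N + 1) j).indicator f :=
        Set.indicator_const_smul (A (N + 1) j) c f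
      rw [this, ih.map_smul, smul_eq_mul]
      ring

lemma _root_.IsLinearMap.map_sum' {E ι : Type*} [AddCommGroup E] [Module ℝ E] {φ : E → ℝ}
    (h : IsLinearMap ℝ φ) (s : Finset ι) (g : ι → E) : φ (∑ i ∈ s, g i) = ∑ i ∈ s, φ (g i) :=
  map_sum h.mk' g s

lemma IsMeasurablePartition.sum_indicator {𝒳 : Type*} [MeasurableSpace 𝒳] {m : ℕ}
    {A : Fin m → Set 𝒳} (hA : IsMeasurablePartition A) (f : 𝒳 → ℝ) :
    ∑ j, (A j).indicator f = f := by
  ext x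
  obtain ⟨j, hj⟩ := Set.mem_iUnion.1 (hA.iUnion_eq ▸ Set.mem_univ x : x ∈ ⋃ j, A j)
  rw [Finset.sum_apply, Finset.sum_eq_single j]
  · simp [hj]
  · intro i _ hij
    exact Set.indicator_of_notMem
      (fun hi => (Set.disjoint_left.1 (hA.pairwise_disjoint hij)) hi hj) _
  · simp

/-! ### Conditional centering and its effect on variance -/

/-- The function `f` minus its conditional expectation given a finite partition. -/
def condCentered {𝒳 : Type*} [MeasurableSpace 𝒳] (P : Measure 𝒳) {m : ℕ} (A : Fin m → Set 𝒳)
    (f : 𝒳 → ℝ) : 𝒳 → ℝ :=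
  f - ∑ j, ((∫ x in A j, f x ∂P) / P.real (A j)) • (A j).indicator (1 : 𝒳 → ℝ)

/-- Successive conditional centerings, starting with the partition `A k` and ending with
`A 1`. -/
def iterCentered {𝒳 : Type*} [MeasurableSpace 𝒳] (P : Measure 𝒳) {mA : ℕ → ℕ}
    (A : (k : ℕ) → Fin (mA k) → Set 𝒳) : ℕ → (𝒳 → ℝ) → 𝒳 → ℝ
  | 0, f => f
  | k + 1, f => iterCentered P A k (condCentered P (A (k + 1)) f)

section Centered

variable {𝒳 : Type*} [MeasurableSpace 𝒳] {P : Measure 𝒳} {m : ℕ} {A : Fin m → Set 𝒳}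
  {f : 𝒳 → ℝ}

lemma IsBddMeasurable.condCentered (hf : IsBddMeasurable f) (hA : IsMeasurablePartition A) :
    IsBddMeasurable (condCentered P A f) :=
  hf.sub (.sum fun j => (IsBddMeasurable.indicator_one (hA.measurableSet j)).const_smul _)

variable [IsProbabilityMeasure P]

lemma setIntegral_condCentered (hf : IsBddMeasurable f) (hA : IsMeasurablePartition A)
    (hA_pos : ∀ j, 0 < P.real (A j)) (i : Fin m) :
    ∫ x in A i, condCentered P A f x ∂P = 0 := by
  have hcongr : ∀ x ∈ A i, condCentered P A f x =
      f x - (∫ x in A i, f x ∂P) / P.real (A i) := by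
    intro x hx
    have h1 : ∀ j, j ≠ i → x ∉ A j := fun j hj hxj =>
      Set.disjoint_left.1 (hA.pairwise_disjoint hj) hxj hx
    simp only [RakingRatio.condCentered, Pi.sub_apply, Finset.sum_apply, Pi.smul_apply]
    rw [Finset.sum_eq_single i (fun j _ hj => by simp [h1 j hj]) (by simp)]
    simp [hx]
  rw [setIntegral_congr_fun (hA.measurableSet i) hcongr,
    integral_sub (hf.integrable P).integrableOn (integrable_const _)]
  simp only [setIntegral_const, smul_eq_mul]
  field_simp [(hA_pos i).ne']
  simp

lemma integral_condCentered (hf : IsBddMeasurable f) (hA : IsMeasurablePartition A)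
    (hA_pos : ∀ j, 0 < P.real (A j)) : ∫ x, condCentered P A f x ∂P = 0 := by
  rw [← setIntegral_univ, ← hA.iUnion_eq,
    integral_iUnion_fintype hA.measurableSet hA.pairwise_disjoint
      fun i => ((hf.condCentered hA).integrable P).integrableOn]
  simp [setIntegral_condCentered hf hA hA_pos]

/-- The removed part is constant on cells, while the centered part integrates to 0 over each cell;
they are uncorrelated and the variances add. -/
lemma variance_condCentered_le (hf : IsBddMeasurable f) (hA : IsMeasurablePartition A)
    (hA_pos : ∀ j, 0 < P.real (A j)) : Var[condCentered P A f; P] ≤ Var[f; P] := by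
  set h := condCentered P A f with hh
  set r : 𝒳 → ℝ := ∑ j, ((∫ x in A j, f x ∂P) / P.real (A j)) • (A j).indicator (1 : 𝒳 → ℝ)
    with hr
  have hfr : f = h + r := by simp [hh, hr, RakingRatio.condCentered]
  have hhb : IsBddMeasurable h := hf.condCentered hA
  have h1b : ∀ j, IsBddMeasurable ((A j).indicator (1 : 𝒳 → ℝ)) := fun j =>
    IsBddMeasurable.indicator_one (hA.measurableSet j)
  have hrb : IsBddMeasurable r := .sum fun j => (h1b j).const_smul _
  have hcov : cov[h, r; P] = 0 := by
    rw [hr, covariance_sum_right (fun j => ((h1b j).const_smul _).memLp P 2) (hhb.memLp P 2)]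
    refine Finset.sum_eq_zero fun j _ => ?_
    rw [covariance_smul_right, covariance_eq_sub (hhb.memLp P 2) ((h1b j).memLp P 2)]
    have h0 : ∫ x, h x ∂P = 0 := integral_condCentered hf hA hA_pos
    have h1 : ∫ x, (h * (A j).indicator (1 : 𝒳 → ℝ)) x ∂P = 0 := by
      rw [← setIntegral_condCentered hf hA hA_pos j, ← integral_indicator (hA.measurableSet j)]
      congr 1
      ext x
      by_cases hx : x ∈ A j <;> simp [hx, hh]
    rw [h0, h1]
    simp
  rw [hfr, variance_add (hhb.memLp P 2) (hrb.memLp P 2), hcov]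
  have := variance_nonneg r P
  linarith

lemma condCentered_sum {ι : Type*} [Fintype ι] {g : ι → 𝒳 → ℝ} (hg : ∀ i, IsBddMeasurable (g i))
    (t : ι → ℝ) :
    condCentered P A (∑ i, t i • g i) = ∑ i, t i • condCentered P A (g i) := by
  have hint : ∀ j, ∫ x in A j, (∑ i, t i • g i) x ∂P = ∑ i, t i * ∫ x in A j, g i x ∂P := by
    intro j
    simp only [Finset.sum_apply, Pi.smul_apply, smul_eq_mul]
    rw [integral_finsetSum _ fun i _ => ((hg i).integrable P).integrableOn.const_mul (t i)]
    simp_rw [integral_const_mul]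
  simp only [RakingRatio.condCentered, hint, smul_sub, Finset.sum_sub_distrib, Finset.smul_sum]
  rw [Finset.sum_comm]
  congr 1
  refine Finset.sum_congr rfl fun j _ => ?_
  rw [Finset.sum_div, Finset.sum_smul]
  refine Finset.sum_congr rfl fun i _ => ?_
  rw [smul_smul, mul_div_assoc]

end Centered

section IterCentered

variable {𝒳 : Type*} [MeasurableSpace 𝒳] {P : Measure 𝒳}
  {mA : ℕ → ℕ} {A : (k : ℕ) → Fin (mA k) → Set 𝒳} {N : ℕ}

lemma IsBddMeasurable.iterCentered (hA : ∀ k ∈ Set.Icc 1 N, IsMeasurablePartition (A k))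
    {f : 𝒳 → ℝ} (hf : IsBddMeasurable f) : IsBddMeasurable (iterCentered P A N f) := by
  induction N generalizing f with
  | zero => exact hf
  | succ N ih =>
    exact ih (fun k hk => hA k ⟨hk.1, hk.2.trans N.le_succ⟩)
      (hf.condCentered (hA (N + 1) ⟨by omega, le_rfl⟩))

variable [IsProbabilityMeasure P]

lemma variance_iterCentered_le (hA : ∀ k ∈ Set.Icc 1 N, IsMeasurablePartition (A k))
    (hA_pos : ∀ k ∈ Set.Icc 1 N, ∀ j, 0 < P.real (A k j)) {f : 𝒳 → ℝ} (hf : IsBddMeasurable f) :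
    Var[iterCentered P A N f; P] ≤ Var[f; P] := by
  induction N generalizing f with
  | zero => exact le_rfl
  | succ N ih =>
    have hmem : N + 1 ∈ Set.Icc 1 (N + 1) := ⟨by omega, le_rfl⟩
    exact (ih (fun k hk => hA k ⟨hk.1, hk.2.trans N.le_succ⟩)
      (fun k hk => hA_pos k ⟨hk.1, hk.2.trans N.le_succ⟩) (hf.condCentered (hA _ hmem))).trans
      (variance_condCentered_le hf (hA _ hmem) (hA_pos _ hmem))

lemma iterCentered_sum (hA : ∀ k ∈ Set.Icc 1 N, IsMeasurablePartition (A k)) {ι : Type*}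
    [Fintype ι] {g : ι → 𝒳 → ℝ} (hg : ∀ i, IsBddMeasurable (g i)) (t : ι → ℝ) :
    iterCentered P A N (∑ i, t i • g i) = ∑ i, t i • iterCentered P A N (g i) := by
  induction N generalizing g with
  | zero => rfl
  | succ N ih =>
    simp only [RakingRatio.iterCentered]
    rw [condCentered_sum hg, ih (fun k hk => hA k ⟨hk.1, hk.2.trans N.le_succ⟩)
      fun i => (hg i).condCentered (hA (N + 1) ⟨by omega, le_rfl⟩)]

end IterCentered

/-! ### Calculus of o_P(1) and O_P(1) -/

/-- Convergence to zero in probability of a sequence of real random variables. -/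
def IsNegligible {Ω : Type*} [MeasurableSpace Ω] (μ : Measure Ω) (Y : ℕ → Ω → ℝ) : Prop :=
  ∀ ε : ℝ, 0 < ε → Tendsto (fun n => μ.real {ω | ε ≤ |Y n ω|}) atTop (𝓝 0)

/-- Asymptotic boundedness in probability of a sequence of real random variables. -/
def IsBddInProb {Ω : Type*} [MeasurableSpace Ω] (μ : Measure Ω) (Y : ℕ → Ω → ℝ) : Prop :=
  ∀ ε : ℝ, 0 < ε → ∃ M : ℝ, 0 < M ∧ ∀ᶠ n in atTop, μ.real {ω | M ≤ |Y n ω|} ≤ ε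

section InProbability

variable {Ω : Type*} [MeasurableSpace Ω] {μ : Measure Ω}
  {X Y Z : ℕ → Ω → ℝ}

lemma isNegligible_zero : IsNegligible μ fun _ _ => 0 := by
  intro ε hε
  have : {ω : Ω | ε ≤ |(0 : ℝ)|} = ∅ := by
    ext ω
    simp [hε]
  simp only [this, measureReal_empty, tendsto_const_nhds_iff]

lemma IsNegligible.isBddInProb (hY : IsNegligible μ Y) : IsBddInProb μ Y := fun _ hε =>
  ⟨1, one_pos, ((hY 1 one_pos).eventually (gt_mem_nhds hε)).mono fun _ h => h.le⟩

lemma isBddInProb_const (c : ℝ) : IsBddInProb μ fun _ _ => c := by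
  intro ε hε
  refine ⟨|c| + 1, by positivity, Eventually.of_forall fun n => ?_⟩
  have : {ω : Ω | |c| + 1 ≤ |c|} = ∅ := by
    ext ω
    simp
  rw [this, measureReal_empty]
  exact hε.le

variable [IsProbabilityMeasure μ]

/-- A sequence dominated by a negligible one wherever another negligible sequence is small. -/
lemma IsNegligible.of_le (hY : IsNegligible μ Y) (hZ : IsNegligible μ Z) {δ : ℝ} (hδ : 0 < δ)
    (h : ∀ᶠ n in atTop, ∀ ω, |Z n ω| < δ → |X n ω| ≤ |Y n ω|) : IsNegligible μ X := by
  intro ε hε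
  have hsum := (hY ε hε).add (hZ δ hδ)
  rw [add_zero] at hsum
  refine squeeze_zero' (Eventually.of_forall fun n => measureReal_nonneg) ?_ hsum
  filter_upwards [h] with n hn
  refine (measureReal_mono fun ω hω => ?_).trans (measureReal_union_le _ _)
  by_cases hz : |Z n ω| < δ
  · exact Or.inl (le_trans hω (hn ω hz))
  · exact Or.inr (not_lt.1 hz)

lemma IsNegligible.add (hX : IsNegligible μ X) (hY : IsNegligible μ Y) :
    IsNegligible μ fun n ω => X n ω + Y n ω := by
  intro ε hε
  have hsum := (hX (ε / 2) (half_pos hε)).add (hY (ε / 2) (half_pos hε))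
  rw [add_zero] at hsum
  refine squeeze_zero (fun n => measureReal_nonneg) (fun n => ?_) hsum
  refine (measureReal_mono fun ω hω => ?_).trans (measureReal_union_le _ _)
  have hω : ε ≤ |X n ω + Y n ω| := hω
  by_contra hcon
  simp only [Set.mem_union, Set.mem_ofPred_eq, not_or, not_le] at hcon
  have := abs_add_le (X n ω) (Y n ω)
  linarith [hcon.1, hcon.2]

lemma IsNegligible.sum {ι : Type*} {s : Finset ι} {Y : ι → ℕ → Ω → ℝ}
    (hY : ∀ i ∈ s, IsNegligible μ (Y i)) : IsNegligible μ fun n ω => ∑ i ∈ s, Y i n ω := by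
  classical
  induction s using Finset.induction with
  | empty => simpa using isNegligible_zero
  | insert i s hi ih =>
    simp_rw [Finset.sum_insert hi]
    exact (hY i (Finset.mem_insert_self i s)).add
      (ih fun j hj => hY j (Finset.mem_insert_of_mem hj))

lemma IsNegligible.const_mul (hY : IsNegligible μ Y) (c : ℝ) :
    IsNegligible μ fun n ω => c * Y n ω := by
  intro ε hε
  refine squeeze_zero (fun n => measureReal_nonneg) (fun n => measureReal_mono fun ω hω => ?_)
    (hY (ε / (|c| + 1)) (by positivity))
  have hω : ε ≤ |c * Y n ω| := hω
  rw [abs_mul] at hω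
  change ε / (|c| + 1) ≤ |Y n ω|
  rw [div_le_iff₀ (by positivity)]
  nlinarith [abs_nonneg (Y n ω)]

lemma IsBddInProb.add (hX : IsBddInProb μ X) (hY : IsBddInProb μ Y) :
    IsBddInProb μ fun n ω => X n ω + Y n ω := by
  intro ε hε
  obtain ⟨M, hM, hXM⟩ := hX (ε / 2) (half_pos hε)
  obtain ⟨M', hM', hYM⟩ := hY (ε / 2) (half_pos hε)
  refine ⟨M + M', by positivity, ?_⟩
  filter_upwards [hXM, hYM] with n h1 h2
  have : μ.real {ω | M + M' ≤ |X n ω + Y n ω|} ≤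
      μ.real {ω | M ≤ |X n ω|} + μ.real {ω | M' ≤ |Y n ω|} := by
    refine (measureReal_mono fun ω hω => ?_).trans (measureReal_union_le _ _)
    have hω : M + M' ≤ |X n ω + Y n ω| := hω
    by_contra hcon
    simp only [Set.mem_union, Set.mem_ofPred_eq, not_or, not_le] at hcon
    have := abs_add_le (X n ω) (Y n ω)
    linarith [hcon.1, hcon.2]
  linarith

lemma IsBddInProb.mul_isNegligible (hX : IsBddInProb μ X) (hY : IsNegligible μ Y) :
    IsNegligible μ fun n ω => X n ω * Y n ω := by
  intro ε hε
  refine tendsto_order.2 ⟨fun a ha => Eventually.of_forall fun n => ha.trans_le measureReal_nonneg,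
    fun a ha => ?_⟩
  obtain ⟨M, hM, hXM⟩ := hX (a / 2) (half_pos ha)
  filter_upwards [hXM, (hY (ε / M) (by positivity)).eventually (gt_mem_nhds (half_pos ha))]
    with n h1 h2
  have : μ.real {ω | ε ≤ |X n ω * Y n ω|} ≤
      μ.real {ω | M ≤ |X n ω|} + μ.real {ω | ε / M ≤ |Y n ω|} := by
    refine (measureReal_mono fun ω hω => ?_).trans (measureReal_union_le _ _)
    have hω : ε ≤ |X n ω * Y n ω| := hω
    by_contra hcon
    simp only [Set.mem_union, Set.mem_ofPred_eq, not_or, not_le] at hcon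
    rw [abs_mul] at hω
    have h3 := (lt_div_iff₀ hM).1 hcon.2
    nlinarith [hcon.1, abs_nonneg (X n ω), abs_nonneg (Y n ω)]
  linarith

lemma isNegligible_of_isBddInProb_sqrt_mul (h : IsBddInProb μ fun n ω => √n * Y n ω) :
    IsNegligible μ Y := by
  have hdet : IsNegligible μ fun n _ => (√(n : ℝ))⁻¹ := by
    intro ε hε
    have hlim : Tendsto (fun n : ℕ => (√(n : ℝ))⁻¹) atTop (𝓝 0) :=
      tendsto_inv_atTop_zero.comp (Real.tendsto_sqrt_atTop.comp tendsto_natCast_atTop_atTop)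
    refine tendsto_const_nhds.congr' ?_
    filter_upwards [hlim.eventually (gt_mem_nhds hε)] with n hn
    have : {ω : Ω | ε ≤ |(√(n : ℝ))⁻¹|} = ∅ := by
      ext ω
      rw [abs_of_nonneg (by positivity)]
      simp [hn]
    rw [this, measureReal_empty]
  refine (h.mul_isNegligible hdet).of_le isNegligible_zero one_pos ?_
  filter_upwards [eventually_gt_atTop 0] with n hn ω _
  have : 0 < √(n : ℝ) := Real.sqrt_pos.2 (by exact_mod_cast hn)
  rw [mul_comm (√(n : ℝ)), mul_assoc, mul_inv_cancel₀ this.ne', mul_one]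

lemma IsNegligible.div_sub_div {a b : ℝ} (hX : IsNegligible μ fun n ω => X n ω - a)
    (hY : IsNegligible μ fun n ω => Y n ω - b) (hb : 0 < b) :
    IsNegligible μ fun n ω => X n ω / Y n ω - a / b := by
  -- On |Y - b| < b/2 the denominator exceeds b/2; replacing it by b/2 in the exact difference of
  -- quotients gives this linear bound.
  refine IsNegligible.of_le
    (Y := fun n ω => (2 / b) * (X n ω - a) + (-(2 * a / b ^ 2)) * (Y n ω - b))
    ((hX.const_mul _).add (hY.const_mul _)) hY (half_pos hb) (Eventually.of_forall fun n ω h => ?_)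
  have hY' : b / 2 < Y n ω := by
    have := (abs_lt.1 h).1
    linarith
  have hY0 : 0 < Y n ω := by linarith
  have h1 : X n ω / Y n ω - a / b = ((X n ω - a) / b * b - a / b * (Y n ω - b)) / Y n ω := by
    field_simp
    ring
  have h2 : (2 / b) * (X n ω - a) + (-(2 * a / b ^ 2)) * (Y n ω - b) =
      ((X n ω - a) / b * b - a / b * (Y n ω - b)) / (b / 2) := by
    field_simp
    ring
  rw [h1, h2, abs_div, abs_div, abs_of_pos hY0, abs_of_pos (half_pos hb)]
  exact div_le_div_of_nonneg_left (abs_nonneg _) (half_pos hb) hY'.le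

end InProbability

/-! ### Consistency and linearization of the raked measure -/

section Linearization

variable {Ω 𝒳 : Type*} [MeasurableSpace Ω] [MeasurableSpace 𝒳] {μ : Measure Ω}
  {P : Measure 𝒳} [IsProbabilityMeasure P] {X : ℕ → Ω → 𝒳} {mA : ℕ → ℕ}
  {A : (k : ℕ) → Fin (mA k) → Set 𝒳} {w : (k : ℕ) → ℕ → Ω → Fin (mA k) → ℝ}

/-- Consistency of the raked empirical measure. -/
theorem ae_tendsto_raked (hX_indep : iIndepFun X μ)
    (hX_law : ∀ i, HasLaw (X i) P μ) {N : ℕ}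
    (hA : ∀ k ∈ Set.Icc 1 N, IsMeasurablePartition (A k))
    (hA_pos : ∀ k ∈ Set.Icc 1 N, ∀ j, 0 < P.real (A k j))
    (hw : ∀ k ∈ Set.Icc 1 N, ∀ j,
      ∀ᵐ ω ∂μ, Tendsto (fun n => w k n ω j) atTop (𝓝 (P.real (A k j))))
    {f : 𝒳 → ℝ} (hf : IsBddMeasurable f) :
    ∀ᵐ ω ∂μ, Tendsto (fun n => raked A (fun k => w k n ω) (fun i => X i ω) n N f) atTop
      (𝓝 (∫ x, f x ∂P)) := by
  induction N generalizing f with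
  | zero =>
    have hlaw : ∀ i, HasLaw (fun ω => f (X i ω)) (P.map f) μ := fun i =>
      HasLaw.comp (X := X i) (Y := f) ⟨hf.1.aemeasurable, rfl⟩ (hX_law i)
    have hind : iIndepFun (fun i ω => f (X i ω)) μ := hX_indep.comp (fun _ => f) fun _ => hf.1
    have hfX : MemLp (fun ω => f (X 0 ω)) 1 μ :=
      MemLp.comp_of_map (g := f) ((hX_law 0).map_eq ▸ hf.memLp P 1) (hX_law 0).aemeasurable
    have := strong_law_ae_real (fun i ω => f (X i ω)) (memLp_one_iff_integrable.1 hfX)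
      (fun i j hij => hind.indepFun hij)
      (fun i => ⟨(hlaw i).aemeasurable, (hlaw 0).aemeasurable,
        (hlaw i).map_eq.trans (hlaw 0).map_eq.symm⟩)
    rwa [← integral_map (f := f) (hX_law 0).aemeasurable hf.1.aestronglyMeasurable,
      (hX_law 0).map_eq] at this
  | succ N ih =>
    have hmem : N + 1 ∈ Set.Icc 1 (N + 1) := ⟨by omega, le_rfl⟩
    have hsub : ∀ k ∈ Set.Icc 1 N, k ∈ Set.Icc 1 (N + 1) := fun k hk =>
      ⟨hk.1, hk.2.trans N.le_succ⟩
    have ih' := fun {f : 𝒳 → ℝ} (hf : IsBddMeasurable f) => ih (fun k hk => hA k (hsub k hk))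
      (fun k hk => hA_pos k (hsub k hk)) (fun k hk => hw k (hsub k hk)) hf
    have hPart := hA _ hmem
    have h1 := ae_all_iff.2 fun j => ih' (.indicator_one (hPart.measurableSet j))
    have h2 := ae_all_iff.2 fun j => ih' (hf.indicator (hPart.measurableSet j))
    have h3 := ae_all_iff.2 fun j => hw _ hmem j
    filter_upwards [h1, h2, h3] with ω h1 h2 h3
    -- A raking step with true weights leaves `P` fixed, so the limit can be matched term by term.
    have hint : ∫ y, f y ∂P = ∑ j, P.real (A (N + 1) j) /
        (∫ y, (A (N + 1) j).indicator 1 y ∂P) * ∫ y, (A (N + 1) j).indicator f y ∂P := by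
      rw [← setIntegral_univ, ← hPart.iUnion_eq,
        integral_iUnion_fintype hPart.measurableSet hPart.pairwise_disjoint
          fun i => (hf.integrable P).integrableOn]
      refine Finset.sum_congr rfl fun j _ => ?_
      rw [integral_indicator_one (hPart.measurableSet j),
        integral_indicator (hPart.measurableSet j), div_self (hA_pos _ hmem j).ne', one_mul]
    rw [hint]
    simp only [raked]
    refine tendsto_finsetSum _ fun j _ => ((h3 j).div (h1 j) ?_).mul (h2 j)
    rw [integral_indicator_one (hPart.measurableSet j)]
    exact (hA_pos _ hmem j).ne'

variable [IsProbabilityMeasure μ]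

lemma isBddInProb_empirical (hX_indep : iIndepFun X μ) (hX_law : ∀ i, HasLaw (X i) P μ)
    {f : 𝒳 → ℝ} (hf : IsBddMeasurable f) :
    IsBddInProb μ fun n ω => √n * (empirical (fun i => X i ω) n f - ∫ x, f x ∂P) := by
  have hfX : ∀ i, MemLp (fun ω => f (X i ω)) 2 μ := fun i =>
    MemLp.comp_of_map (g := f) ((hX_law i).map_eq ▸ hf.memLp P 2) (hX_law i).aemeasurable
  have hmean : ∀ i, ∫ ω, f (X i ω) ∂μ = ∫ x, f x ∂P := fun i => by
    rw [← (hX_law i).map_eq, integral_map (hX_law i).aemeasurable hf.1.aestronglyMeasurable]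
  have hvar : ∀ i, Var[fun ω => f (X i ω); μ] = Var[f; P] := fun i => by
    rw [← (hX_law i).map_eq, variance_map hf.1.aemeasurable (hX_law i).aemeasurable]
    rfl
  have hind : iIndepFun (fun i ω => f (X i ω)) μ := hX_indep.comp (fun _ => f) fun _ => hf.1
  intro ε hε
  set v := Var[f; P] with hv
  have hv0 : 0 ≤ v := variance_nonneg _ _
  -- Chebyshev: for n ≥ 1 the normalized mean has variance `v`, whatever n. The added 1 keeps the
  -- bound positive when `v = 0`.
  refine ⟨√((v + 1) / ε), Real.sqrt_pos.2 (by positivity), Eventually.of_forall fun n => ?_⟩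
  set M := √((v + 1) / ε) with hM
  have hMpos : 0 < M := Real.sqrt_pos.2 (by positivity)
  have hM2 : M ^ 2 = (v + 1) / ε := Real.sq_sqrt (by positivity)
  simp_rw [sqrt_mul_empirical_sub]
  rcases Nat.eq_zero_or_pos n with rfl | hn
  · have : {ω : Ω | M ≤ |(√((0 : ℕ) : ℝ))⁻¹ * (∑ k ∈ Finset.range 0, f (X k ω) -
        ((0 : ℕ) : ℝ) * ∫ x, f x ∂P)|} = ∅ := by
      ext ω
      simp [hMpos]
    rw [this]
    simpa using hε.le
  have hn' : (0 : ℝ) < n := by exact_mod_cast hn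
  have hsq : 0 < √(n : ℝ) := Real.sqrt_pos.2 hn'
  have hS : MemLp (∑ k ∈ Finset.range n, fun ω => f (X k ω)) 2 μ :=
    memLp_finsetSum' _ fun k _ => hfX k
  have hSmean : ∫ ω, (∑ k ∈ Finset.range n, fun ω => f (X k ω)) ω ∂μ = n * ∫ x, f x ∂P := by
    simp only [Finset.sum_apply]
    rw [integral_finsetSum _ fun k _ => (hfX k).integrable (by simp)]
    simp [hmean]
  have hSvar : Var[∑ k ∈ Finset.range n, fun ω => f (X k ω); μ] = n * v := by
    rw [IndepFun.variance_sum (fun k _ => hfX k) fun i _ j _ hij => hind.indepFun hij]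
    simp [hvar]
  have hcheb := meas_ge_le_variance_div_sq hS (c := M * √(n : ℝ)) (by positivity)
  rw [hSmean, hSvar] at hcheb
  have hset : {ω | M ≤ |(√(n : ℝ))⁻¹ * (∑ k ∈ Finset.range n, f (X k ω) - n * ∫ x, f x ∂P)|} =
      {ω | M * √(n : ℝ) ≤ |(∑ k ∈ Finset.range n, fun ω => f (X k ω)) ω - n * ∫ x, f x ∂P|} := by
    ext ω
    simp only [Set.mem_ofPred_eq, Finset.sum_apply]
    rw [abs_mul, abs_of_pos (inv_pos.2 hsq), inv_mul_eq_div, le_div_iff₀ hsq]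
  rw [hset, measureReal_def]
  refine (ENNReal.toReal_mono ENNReal.ofReal_ne_top hcheb).trans ?_
  rw [ENNReal.toReal_ofReal (by positivity), mul_pow, hM2, Real.sq_sqrt hn'.le,
    div_le_iff₀ (by positivity)]
  field_simp
  linarith

/-- An exact identity that isolates the error of a single raking step, cell by cell, so that each
summand can be shown to be o(n^{-1/2}) in probability. -/
lemma raked_succ_sub_eq {N : ℕ} (hA : IsMeasurablePartition (A (N + 1)))
    {f : 𝒳 → ℝ} (hf : IsBddMeasurable f)
    (p : (k : ℕ) → Fin (mA k) → ℝ) (x : ℕ → 𝒳) (n : ℕ) :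
    raked A p x n (N + 1) f - ∫ y, f y ∂P - raked A p x n N (condCentered P (A (N + 1)) f) =
      ∑ j, (p (N + 1) j / raked A p x n N ((A (N + 1) j).indicator 1) *
          raked A p x n N ((A (N + 1) j).indicator f)
        - (∫ y in A (N + 1) j, f y ∂P) - raked A p x n N ((A (N + 1) j).indicator f)
        + (∫ y in A (N + 1) j, f y ∂P) / P.real (A (N + 1) j) *
          raked A p x n N ((A (N + 1) j).indicator 1)) := by
  have hlin := isLinearMap_raked A p x n N
  have hint : ∫ y, f y ∂P = ∑ j, ∫ y in A (N + 1) j, f y ∂P := by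
    rw [← setIntegral_univ, ← hA.iUnion_eq,
      integral_iUnion_fintype hA.measurableSet hA.pairwise_disjoint
        fun i => (hf.integrable P).integrableOn]
  have hQ : raked A p x n N (condCentered P (A (N + 1)) f) =
      ∑ j, raked A p x n N ((A (N + 1) j).indicator f) -
      ∑ j, (∫ y in A (N + 1) j, f y ∂P) / P.real (A (N + 1) j) *
          raked A p x n N ((A (N + 1) j).indicator 1) := by
    rw [condCentered, hlin.map_sub, ← hlin.map_sum' _ fun j => (A (N + 1) j).indicator f,
      hA.sum_indicator, hlin.map_sum']
    simp_rw [hlin.map_smul, smul_eq_mul]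
  rw [hQ, hint, raked]
  simp only [Finset.sum_add_distrib, Finset.sum_sub_distrib]
  ring

/-- To first order, raking replaces the indicator functions by their iterated conditional
centerings. -/
theorem isNegligible_raked_sub_empirical (hX_indep : iIndepFun X μ)
    (hX_law : ∀ i, HasLaw (X i) P μ) {N : ℕ}
    (hA : ∀ k ∈ Set.Icc 1 N, IsMeasurablePartition (A k))
    (hA_pos : ∀ k ∈ Set.Icc 1 N, ∀ j, 0 < P.real (A k j))
    (hw : ∀ k ∈ Set.Icc 1 N, ∀ j, IsNegligible μ fun n ω => √n * (w k n ω j - P.real (A k j)))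
    {f : 𝒳 → ℝ} (hf : IsBddMeasurable f) :
    IsNegligible μ fun n ω =>
      √n * (raked A (fun k => w k n ω) (fun i => X i ω) n N f - ∫ x, f x ∂P) -
      √n * (empirical (fun i => X i ω) n (iterCentered P A N f) -
        ∫ x, iterCentered P A N f x ∂P) := by
  induction N generalizing f with
  | zero =>
    simp only [raked, iterCentered, sub_self]
    exact isNegligible_zero
  | succ N ih =>
    have hmem : N + 1 ∈ Set.Icc 1 (N + 1) := ⟨by omega, le_rfl⟩
    have hsub : ∀ k ∈ Set.Icc 1 N, k ∈ Set.Icc 1 (N + 1) := fun k hk =>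
      ⟨hk.1, hk.2.trans N.le_succ⟩
    have ih' := fun {f : 𝒳 → ℝ} (hf : IsBddMeasurable f) => ih (fun k hk => hA k (hsub k hk))
      (fun k hk => hA_pos k (hsub k hk)) (fun k hk => hw k (hsub k hk)) hf
    have hbdd : ∀ g : 𝒳 → ℝ, IsBddMeasurable g → IsBddInProb μ fun n ω =>
        √n * (raked A (fun k => w k n ω) (fun i => X i ω) n N g - ∫ x, g x ∂P) := by
      intro g hg
      have := (ih' hg).isBddInProb.add (isBddInProb_empirical hX_indep hX_law
        (hg.iterCentered (P := P) fun k hk => hA k (hsub k hk)))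
      simpa only [sub_add_cancel] using this
    have hPart := hA _ hmem
    have hPos := hA_pos _ hmem
    have hstep : IsNegligible μ fun n ω =>
        √n * (raked A (fun k => w k n ω) (fun i => X i ω) n (N + 1) f - ∫ x, f x ∂P -
          raked A (fun k => w k n ω) (fun i => X i ω) n N (condCentered P (A (N + 1)) f)) := by
      simp_rw [raked_succ_sub_eq hPart hf, Finset.mul_sum]
      refine IsNegligible.sum fun j _ => ?_
      set p := P.real (A (N + 1) j) with hp
      have hppos : 0 < p := hPos j
      set e := ∫ y in A (N + 1) j, f y ∂P with he
      set q : ℕ → Ω → ℝ := fun n ω =>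
        raked A (fun k => w k n ω) (fun i => X i ω) n N ((A (N + 1) j).indicator 1) with hq
      set s : ℕ → Ω → ℝ := fun n ω =>
        raked A (fun k => w k n ω) (fun i => X i ω) n N ((A (N + 1) j).indicator f) with hs
      have hqb : IsBddInProb μ fun n ω => √n * (q n ω - p) := by
        have := hbdd _ (.indicator_one (hPart.measurableSet j))
        rwa [integral_indicator_one (hPart.measurableSet j)] at this
      have hsb : IsBddInProb μ fun n ω => √n * (s n ω - e) := by
        have := hbdd _ (hf.indicator (hPart.measurableSet j))
        rwa [integral_indicator (hPart.measurableSet j)] at this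
      have hqn := isNegligible_of_isBddInProb_sqrt_mul hqb
      have hr := (isNegligible_of_isBddInProb_sqrt_mul hsb).div_sub_div hqn hppos
      have hrb : IsBddInProb μ fun n ω => s n ω / q n ω := by
        simpa only [sub_add_cancel] using hr.isBddInProb.add (isBddInProb_const (e / p))
      -- With w the weight, the summand equals (s/q)(w - p) - (q - p)(s/q - e/p) when q ≠ 0. After
      -- scaling by √n, each product has one factor bounded and one negligible in probability. The
      -- event |q - p| < p excludes q = 0.
      have hmain := (hrb.mul_isNegligible (hw _ hmem j)).add
        ((hqb.mul_isNegligible hr).const_mul (-1))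
      refine hmain.of_le hqn hppos (Eventually.of_forall fun n ω hω => le_of_eq ?_)
      have hq0 : q n ω ≠ 0 := by
        intro h0
        rw [h0, zero_sub, abs_neg, abs_of_pos hppos] at hω
        exact lt_irrefl _ hω
      congr 1
      change √n * (w (N + 1) n ω j / q n ω * s n ω - e - s n ω + e / p * q n ω) =
        s n ω / q n ω * (√n * (w (N + 1) n ω j - p)) +
          -1 * (√n * (q n ω - p) * (s n ω / q n ω - e / p))
      field_simp
      ring
    have hfin := hstep.add (ih' (hf.condCentered (P := P) hPart))
    -- The centered function has mean 0, so the inductive hypothesis applies to its raked value with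
    -- no centering term.
    rw [integral_condCentered hf hPart hPos] at hfin
    refine hfin.of_le isNegligible_zero one_pos (Eventually.of_forall fun n ω _ => le_of_eq ?_)
    simp only [iterCentered]
    congr 1
    ring

end Linearization

/-! ### Concentration of multinomial frequencies and learned weights -/

lemma isProbabilityMeasure_categorical {m : ℕ} {p : Fin m → ℝ} (hp : ∀ j, 0 ≤ p j)
    (hsum : ∑ j, p j = 1) : IsProbabilityMeasure (categorical p) := by
  constructor
  simp only [categorical, Measure.coe_finsetSum, Finset.sum_apply, Measure.smul_apply,
    measure_univ, smul_eq_mul, mul_one]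
  rw [← ENNReal.ofReal_sum_of_nonneg fun j _ => hp j, hsum, ENNReal.ofReal_one]

lemma categorical_real_singleton {m : ℕ} {p : Fin m → ℝ} (hp : ∀ j, 0 ≤ p j) (j : Fin m) :
    (categorical p).real {j} = p j := by
  rw [measureReal_def]
  simp only [categorical, Measure.coe_finsetSum, Finset.sum_apply, Measure.smul_apply,
    smul_eq_mul, Measure.dirac_apply' _ (measurableSet_singleton j)]
  rw [Finset.sum_eq_single j]
  · simp [hp j]
  · intro i _ hij
    simp [hij]
  · simp

/-- Hoeffding's inequality for multinomial frequencies. -/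
lemma multinomialFreq_abs_sub_ge_le {m : ℕ} {p : Fin m → ℝ} (hp : ∀ j, 0 ≤ p j)
    (hsum : ∑ j, p j = 1) {n : ℕ} (hn : 0 < n) (j : Fin m) {ε : ℝ} (hε : 0 < ε) :
    (multinomialFreq n p).real {v | ε ≤ |v j - p j|} ≤ 2 * Real.exp (-2 * n * ε ^ 2) := by
  have := isProbabilityMeasure_categorical hp hsum
  have hn' : (0 : ℝ) < n := by exact_mod_cast hn
  set π := Measure.pi fun _ : Fin n => categorical p with hπ
  set Y : Fin m → ℝ := fun y => ({j} : Set (Fin m)).indicator 1 y with hY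
  have hYint : ∫ y, Y y ∂categorical p = p j := by
    rw [← categorical_real_singleton hp j, ← integral_indicator_one (measurableSet_singleton j)]
  have hmeas : MeasurableSet {v : Fin m → ℝ | ε ≤ |v j - p j|} :=
    measurableSet_le measurable_const (by fun_prop)
  have hrep : (multinomialFreq n p).real {v | ε ≤ |v j - p j|} =
      π.real {y | n * ε ≤ |∑ i, (Y (y i) - p j)|} := by
    rw [multinomialFreq, multinomial, Measure.map_map (by fun_prop) .of_discrete,
      map_measureReal_apply ((measurable_of_countable _).comp .of_discrete) hmeas]
    congr 1
    ext y
    simp only [Set.mem_preimage, Set.mem_ofPred_eq, Function.comp_apply]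
    have hcard : ((Finset.univ.filter fun i => y i = j).card : ℝ) = ∑ i, Y (y i) := by
      rw [Finset.card_filter]
      push_cast
      refine Finset.sum_congr rfl fun i _ => ?_
      simp [hY, Set.indicator_apply]
    have hdiff : ∑ i, (Y (y i) - p j) = n * ((∑ i, Y (y i)) / n - p j) := by
      rw [Finset.sum_sub_distrib]
      simp
      field_simp
    rw [hcard, hdiff, abs_mul, abs_of_pos hn']
    constructor
    · intro h; exact mul_le_mul_of_nonneg_left h hn'.le
    · intro h; exact le_of_mul_le_mul_left h hn'
  have hsub : HasSubgaussianMGF (fun y => Y y - p j) ((‖(1 : ℝ) - 0‖₊ / 2) ^ 2)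
      (categorical p) := by
    have := hasSubgaussianMGF_of_mem_Icc (μ := categorical p) (X := Y) (a := 0) (b := 1)
      (measurable_of_countable _).aemeasurable (ae_of_all _ fun y => by
        by_cases h : y = j <;> simp [hY, h])
    rwa [hYint] at this
  have hpres : ∀ i : Fin n, MeasurePreserving (fun y : Fin n → Fin m => y i) π (categorical p) :=
    fun i => measurePreserving_eval _ i
  have hsub1 : ∀ i : Fin n, HasSubgaussianMGF (fun y : Fin n → Fin m => Y (y i) - p j)
      ((‖(1 : ℝ) - 0‖₊ / 2) ^ 2) π := fun i =>
    HasSubgaussianMGF.of_map (Y := fun y : Fin n → Fin m => y i) (X := fun y => Y y - p j)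
      (hpres i).measurable.aemeasurable ((hpres i).map_eq ▸ hsub)
  have hind : iIndepFun (fun (i : Fin n) (y : Fin n → Fin m) => Y (y i) - p j) π :=
    iIndepFun_pi (X := fun _ y => Y y - p j) fun i => (measurable_of_countable _).aemeasurable
  have hup := HasSubgaussianMGF.measure_sum_ge_le_of_iIndepFun hind (s := Finset.univ)
    (fun i _ => hsub1 i) (ε := n * ε) (by positivity)
  have hlow := HasSubgaussianMGF.measure_sum_ge_le_of_iIndepFun
    (X := fun (i : Fin n) (y : Fin n → Fin m) => -(Y (y i) - p j))
    (hind.comp (fun _ x => -x) fun _ => measurable_neg) (s := Finset.univ)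
    (fun i _ => (hsub1 i).neg) (ε := n * ε) (by positivity)
  -- Each indicator, with values in [0, 1], has variance proxy 1/4.
  have hexp : -(n * ε) ^ 2 / (2 * ((∑ _i : Fin n, (‖(1 : ℝ) - 0‖₊ / 2) ^ 2 : NNReal) : ℝ)) =
      -2 * n * ε ^ 2 := by
    simp
    field_simp
  rw [hexp] at hup hlow
  rw [hrep]
  have hunion : π.real {y | n * ε ≤ |∑ i, (Y (y i) - p j)|} ≤
      π.real {y | n * ε ≤ ∑ i, (Y (y i) - p j)} + π.real {y | n * ε ≤ ∑ i, -(Y (y i) - p j)} := by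
    refine (measureReal_mono fun y hy => ?_).trans (measureReal_union_le _ _)
    have hy : n * ε ≤ |∑ i, (Y (y i) - p j)| := hy
    rcases le_abs.1 hy with h | h
    · exact Or.inl h
    · right
      change n * ε ≤ ∑ i, -(Y (y i) - p j)
      rwa [Finset.sum_neg_distrib]
  linarith

section Learned

variable {Ω 𝒳 : Type*} [MeasurableSpace Ω] [MeasurableSpace 𝒳] {μ : Measure Ω}
  {P : Measure 𝒳} [IsProbabilityMeasure P] {m : ℕ} {A : Fin m → Set 𝒳} {size : ℕ → ℕ}
  {learned : ℕ → Ω → Fin m → ℝ}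

lemma IsMeasurablePartition.sum_measureReal (hA : IsMeasurablePartition A) :
    ∑ j, P.real (A j) = 1 := by
  rw [← measureReal_iUnion_fintype hA.pairwise_disjoint hA.measurableSet, hA.iUnion_eq,
    probReal_univ]

lemma measureReal_learned_le (hA : IsMeasurablePartition A)
    (hsize : ∀ n, 1 ≤ n → n < size n)
    (hlearned : ∀ n, 1 ≤ n →
      HasLaw (learned n) (multinomialFreq (size n) fun j => P.real (A j)) μ)
    {n : ℕ} (hn : 1 ≤ n) (j : Fin m) {ε : ℝ} (hε : 0 < ε) :
    μ.real {ω | ε ≤ |learned n ω j - P.real (A j)|} ≤ 2 * Real.exp (-2 * size n * ε ^ 2) := by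
  rw [(hlearned n hn).measureReal_eq (p := fun v => ε ≤ |v j - P.real (A j)|)
    (measurableSet_le measurable_const (by fun_prop))]
  exact multinomialFreq_abs_sub_ge_le (fun j => measureReal_nonneg) hA.sum_measureReal
    (by have := hsize n hn; omega) j hε

/-- Hoeffding's bound at deviation ε/√n is 2 exp(-2ε² size/n), which vanishes as size/n → ∞. -/
lemma isNegligible_learned (hA : IsMeasurablePartition A)
    (hsize : ∀ n, 1 ≤ n → n < size n)
    (hlearned : ∀ n, 1 ≤ n →
      HasLaw (learned n) (multinomialFreq (size n) fun j => P.real (A j)) μ)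
    (hlim : Tendsto (fun n => (size n : ℝ) / n) atTop atTop) (j : Fin m) :
    IsNegligible μ fun n ω => √n * (learned n ω j - P.real (A j)) := by
  intro ε hε
  have h0 : Tendsto (fun n => 2 * Real.exp (-((2 * ε ^ 2) * ((size n : ℝ) / n)))) atTop
      (𝓝 (2 * 0)) :=
    (Real.tendsto_exp_neg_atTop_nhds_zero.comp
      (hlim.const_mul_atTop (by positivity))).const_mul 2
  rw [mul_zero] at h0
  refine squeeze_zero' (Eventually.of_forall fun n => measureReal_nonneg) ?_ h0
  filter_upwards [eventually_ge_atTop 1] with n hn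
  have hn' : (0 : ℝ) < n := by exact_mod_cast hn
  have hs : 0 < √(n : ℝ) := Real.sqrt_pos.2 hn'
  have h := measureReal_learned_le hA hsize hlearned hn j (ε := ε / √n) (by positivity)
  have hset : {ω | ε ≤ |√n * (learned n ω j - P.real (A j))|} =
      {ω | ε / √n ≤ |learned n ω j - P.real (A j)|} := by
    ext ω
    simp only [Set.mem_ofPred_eq]
    rw [abs_mul, abs_of_pos hs, div_le_iff₀' hs]
  rw [hset]
  refine h.trans (le_of_eq ?_)
  rw [div_pow, Real.sq_sqrt hn'.le]
  congr 2
  ring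

/-- Since size > n, Hoeffding's bounds are dominated by a geometric series. Borel–Cantelli then
applies whatever the joint law across n, over the countably many thresholds 1/(r + 1). -/
lemma ae_tendsto_learned [IsProbabilityMeasure μ] (hA : IsMeasurablePartition A)
    (hsize : ∀ n, 1 ≤ n → n < size n)
    (hlearned : ∀ n, 1 ≤ n →
      HasLaw (learned n) (multinomialFreq (size n) fun j => P.real (A j)) μ) (j : Fin m) :
    ∀ᵐ ω ∂μ, Tendsto (fun n => learned n ω j) atTop (𝓝 (P.real (A j))) := by
  have hev : ∀ r : ℕ, ∀ᵐ ω ∂μ, ∀ᶠ n in atTop,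
      ω ∉ {ω | 1 / ((r : ℝ) + 1) ≤ |learned n ω j - P.real (A j)|} := by
    intro r
    set ε : ℝ := 1 / ((r : ℝ) + 1) with hε
    have hεpos : 0 < ε := by positivity
    refine ae_eventually_notMem ?_
    have hsummable : Summable fun n => μ.real {ω | ε ≤ |learned n ω j - P.real (A j)|} := by
      have hgeom : Summable fun n : ℕ => 2 * Real.exp (n * (-(2 * ε ^ 2))) :=
        (Real.summable_exp_nat_mul_iff.2 (by nlinarith [sq_pos_of_pos hεpos])).mul_left 2
      refine Summable.of_norm_bounded_eventually_nat hgeom ?_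
      filter_upwards [eventually_ge_atTop 1] with n hn
      rw [Real.norm_of_nonneg measureReal_nonneg]
      refine (measureReal_learned_le hA hsize hlearned hn j hεpos).trans ?_
      refine mul_le_mul_of_nonneg_left (Real.exp_le_exp.2 ?_) zero_le_two
      have : (n : ℝ) ≤ size n := by exact_mod_cast (hsize n hn).le
      nlinarith [sq_pos_of_pos hεpos]
    rw [tsum_congr fun n => (ofReal_measureReal (μ := μ)
      (s := {ω | ε ≤ |learned n ω j - P.real (A j)|})).symm,
      ← ENNReal.ofReal_tsum_of_nonneg (fun n => measureReal_nonneg) hsummable]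
    exact ENNReal.ofReal_ne_top
  filter_upwards [ae_all_iff.2 hev] with ω hω
  rw [Metric.tendsto_nhds]
  intro δ hδ
  obtain ⟨r, hr⟩ := exists_nat_one_div_lt hδ
  filter_upwards [hω r] with n hn
  simp only [not_le] at hn
  rw [Real.dist_eq]
  exact hn.trans hr

end Learned

/-- The little-o bound with constant 1 gives size/n ≥ log n eventually. -/
lemma tendsto_size_div_atTop {size : ℕ → ℕ → ℕ} {N : ℕ}
    (h : (fun n : ℕ => (n : ℝ) * Real.log n) =o[atTop] (fun n => (minSize size N n : ℝ)))
    {k : ℕ} (hk : k ∈ Set.Icc 1 N) :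
    Tendsto (fun n => (size k n : ℝ) / n) atTop atTop := by
  have hlog : Tendsto (fun n : ℕ => Real.log n) atTop atTop :=
    Real.tendsto_log_atTop.comp tendsto_natCast_atTop_atTop
  refine tendsto_atTop_mono' _ ?_ hlog
  filter_upwards [h.bound one_pos, eventually_gt_atTop 0] with n hn hn0
  have hn' : (0 : ℝ) < n := by exact_mod_cast hn0
  rw [one_mul, Real.norm_of_nonneg (Nat.cast_nonneg _)] at hn
  have hmin : minSize size N n ≤ size k n := Nat.sInf_le ⟨k, hk, rfl⟩
  have hmin' : (minSize size N n : ℝ) ≤ size k n := by exact_mod_cast hmin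
  rw [le_div_iff₀ hn', mul_comm]
  exact (le_abs_self _).trans (hn.trans hmin')

/-! ### Limit laws of the chi-square statistics -/

section ChiStat

variable {Ω 𝒳 : Type*} [MeasurableSpace Ω] [MeasurableSpace 𝒳] {μ : Measure Ω}
  {P P₀ : Measure 𝒳} {X : ℕ → Ω → 𝒳} {m : ℕ} {B : Fin m → Set 𝒳} {N : ℕ} {mA : ℕ → ℕ}
  {A : (k : ℕ) → Fin (mA k) → Set 𝒳}

lemma aemeasurable_raked (hX_law : ∀ i, HasLaw (X i) P μ)
    (hA : ∀ k ∈ Set.Icc 1 N, IsMeasurablePartition (A k))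
    {p : (k : ℕ) → Ω → Fin (mA k) → ℝ}
    (hp : ∀ k ∈ Set.Icc 1 N, ∀ j, AEMeasurable (fun ω => p k ω j) μ) (n : ℕ) {f : 𝒳 → ℝ}
    (hf : Measurable f) :
    AEMeasurable (fun ω => raked A (fun k => p k ω) (fun i => X i ω) n N f) μ := by
  induction N generalizing f with
  | zero => exact aemeasurable_empirical hX_law hf n
  | succ N ih =>
    have hmem : N + 1 ∈ Set.Icc 1 (N + 1) := ⟨by omega, le_rfl⟩
    have ih' := fun {f : 𝒳 → ℝ} (hf : Measurable f) =>
      ih (fun k hk => hA k ⟨hk.1, hk.2.trans N.le_succ⟩)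
        (fun k hk => hp k ⟨hk.1, hk.2.trans N.le_succ⟩) hf
    have hAm := (hA _ hmem).measurableSet
    simp only [raked]
    exact Finset.aemeasurable_fun_sum _ fun j _ =>
      ((hp _ hmem j).div (ih' (measurable_one.indicator (hAm j)))).mul (ih' (hf.indicator (hAm j)))

/-- The first-order approximations of the normalized cell frequencies of the raked measure. -/
def rakedScore (P : Measure 𝒳) (A : (k : ℕ) → Fin (mA k) → Set 𝒳) (B : Fin m → Set 𝒳) (N : ℕ)
    (i : Fin m) : 𝒳 → ℝ :=
  (√(P.real (B i)))⁻¹ • iterCentered P A N ((B i).indicator 1)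

/-- The vector of the normalized deviations of an estimate `Q` of `P`, whose squared norm is
the chi-square statistic. -/
def chiVector (P : Measure 𝒳) (B : Fin m → Set 𝒳) (n : ℕ) (Q : (𝒳 → ℝ) → ℝ) :
    EuclideanSpace ℝ (Fin m) :=
  WithLp.toLp 2 fun i => (√(P.real (B i)))⁻¹ * (√n * (Q ((B i).indicator 1) - P.real (B i)))

lemma norm_chiVector_sq (hH : ∀ i, P.real (B i) = P₀.real (B i)) (n : ℕ) (Q : (𝒳 → ℝ) → ℝ) :
    ‖chiVector P B n Q‖ ^ 2 = chiStat B P₀ n Q := by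
  rw [EuclideanSpace.real_norm_sq_eq, chiStat, Finset.mul_sum]
  refine Finset.sum_congr rfl fun i _ => ?_
  simp only [chiVector, hH]
  rw [mul_pow, mul_pow, inv_pow, Real.sq_sqrt measureReal_nonneg, Real.sq_sqrt (Nat.cast_nonneg n)]
  ring

lemma isBddMeasurable_rakedScore (hB : IsMeasurablePartition B)
    (hA : ∀ k ∈ Set.Icc 1 N, IsMeasurablePartition (A k)) (i : Fin m) :
    IsBddMeasurable (rakedScore P A B N i) :=
  ((IsBddMeasurable.indicator_one (hB.measurableSet i)).iterCentered hA).const_smul _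

lemma norm_le_sum_abs (x : EuclideanSpace ℝ (Fin m)) : ‖x‖ ≤ ∑ i, |x i| := by
  have h := (EuclideanSpace.basisFun (Fin m) ℝ).sum_repr x
  calc ‖x‖ = ‖∑ i, (EuclideanSpace.basisFun (Fin m) ℝ).repr x i •
        EuclideanSpace.basisFun (Fin m) ℝ i‖ := by rw [h]
    _ ≤ ∑ i, ‖(EuclideanSpace.basisFun (Fin m) ℝ).repr x i •
        EuclideanSpace.basisFun (Fin m) ℝ i‖ := norm_sum_le _ _
    _ = ∑ i, |x i| := by simp [norm_smul]

/-- A chi-square statistic computed from a consistent estimate of a law which differs from `P₀`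
on some cell eventually exceeds any level. -/
lemma eventually_lt_abs_chiStat (hB_pos : ∀ i, 0 < P₀.real (B i)) {Q : ℕ → (𝒳 → ℝ) → ℝ}
    {i : Fin m} (hi : P.real (B i) ≠ P₀.real (B i))
    (hQ : Tendsto (fun n => Q n ((B i).indicator 1)) atTop (𝓝 (P.real (B i)))) (c : ℝ) :
    ∀ᶠ n in atTop, c < |chiStat B P₀ n (Q n)| := by
  have hlim : Tendsto (fun n => (Q n ((B i).indicator 1) - P₀.real (B i)) ^ 2 / P₀.real (B i))
      atTop (𝓝 ((P.real (B i) - P₀.real (B i)) ^ 2 / P₀.real (B i))) :=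
    ((hQ.sub_const _).pow 2).div_const _
  have hpos : 0 < (P.real (B i) - P₀.real (B i)) ^ 2 / P₀.real (B i) :=
    div_pos (sq_pos_of_ne_zero (sub_ne_zero.2 hi)) (hB_pos i)
  -- One discrepant cell already contributes n times a quantity with positive limit; the other cells
  -- contribute nonnegatively.
  have htop := tendsto_natCast_atTop_atTop.atTop_mul_pos hpos hlim
  filter_upwards [htop.eventually_gt_atTop c] with n hn
  refine hn.trans_le (le_trans ?_ (le_abs_self _))
  rw [chiStat]
  refine mul_le_mul_of_nonneg_left ?_ (Nat.cast_nonneg n)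
  exact Finset.single_le_sum
    (f := fun i => (Q n ((B i).indicator 1) - P₀.real (B i)) ^ 2 / P₀.real (B i))
    (fun j _ => div_nonneg (sq_nonneg _) measureReal_nonneg) (Finset.mem_univ i)

variable [IsProbabilityMeasure P]

/-- The chi-square statistic of a raked empirical measure converges in law to a quadratic form
in a standard Gaussian vector. -/
theorem tendsto_measureReal_lt_chiStat_raked [IsProbabilityMeasure μ]
    (hX_indep : iIndepFun X μ) (hX_law : ∀ i, HasLaw (X i) P μ)
    (hB : IsMeasurablePartition B) (hH : ∀ i, P.real (B i) = P₀.real (B i))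
    (hA : ∀ k ∈ Set.Icc 1 N, IsMeasurablePartition (A k))
    (hA_pos : ∀ k ∈ Set.Icc 1 N, ∀ j, 0 < P.real (A k j))
    {w : (k : ℕ) → ℕ → Ω → Fin (mA k) → ℝ}
    (hwm : ∀ k ∈ Set.Icc 1 N, ∀ n, 1 ≤ n → ∀ j, AEMeasurable (fun ω => w k n ω j) μ)
    (hw : ∀ k ∈ Set.Icc 1 N, ∀ j, IsNegligible μ fun n ω => √n * (w k n ω j - P.real (A k j)))
    {c : ℝ} (hc : 0 < c) :
    Tendsto (fun n => μ.real {ω | c < chiStat B P₀ n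
        (raked A (fun k => w k n ω) (fun i => X i ω) n N)}) atTop
      (𝓝 ((stdGaussian (EuclideanSpace ℝ (Fin m))).real
        {x | c < x.ofLp ⬝ᵥ (covMatrix P (rakedScore P A B N)).mulVec x.ofLp})) := by
  have hscore := fun i => isBddMeasurable_rakedScore (P := P) (N := N) hB hA i
  have hclt := tendstoInDistribution_empVector hX_indep hX_law (fun i => (hscore i).1)
    (fun i => (hscore i).memLp P 2)
  set W : ℕ → Ω → EuclideanSpace ℝ (Fin m) := fun n ω =>
    chiVector P B n (raked A (fun k => w k n ω) (fun i => X i ω) n N) with hW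
  have hWm : ∀ n, AEMeasurable (W n) μ := by
    intro n
    -- Nothing is assumed on the weights at n = 0, but there the factor √0 annihilates the vector.
    rcases Nat.eq_zero_or_pos n with rfl | hn
    · have : W 0 = fun _ => 0 := by
        ext ω i
        simp [hW, chiVector]
      rw [this]
      exact aemeasurable_const
    · refine (WithLp.measurable_toLp 2 _).comp_aemeasurable (aemeasurable_pi_lambda _ fun i => ?_)
      exact (((aemeasurable_raked hX_law hA (fun k hk j => hwm k hk n hn j) n
        (measurable_one.indicator (hB.measurableSet i))).sub_const _).const_mul _).const_mul _
  -- Slutsky: by the linearization, the chi-square vector and the empirical vector of the scores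
  -- share their limit.
  have hdiff : TendstoInMeasure μ (W - empVector P X (rakedScore P A B N)) atTop 0 := by
    rw [tendstoInMeasure_iff_measureReal_norm]
    intro ε hε
    have hneg : IsNegligible μ fun n ω => ∑ i, |(√(P.real (B i)))⁻¹ *
        (√n * (raked A (fun k => w k n ω) (fun i => X i ω) n N ((B i).indicator 1) -
            ∫ x, (B i).indicator 1 x ∂P) -
          √n * (empirical (fun i => X i ω) n (iterCentered P A N ((B i).indicator 1)) -
            ∫ x, iterCentered P A N ((B i).indicator 1) x ∂P))| := by
      refine IsNegligible.sum fun i _ => ?_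
      refine ((isNegligible_raked_sub_empirical hX_indep hX_law hA hA_pos hw
        (.indicator_one (hB.measurableSet i))).const_mul _).of_le isNegligible_zero one_pos
        (Eventually.of_forall fun n ω _ => le_of_eq (abs_abs _))
    refine squeeze_zero (fun n => measureReal_nonneg) (fun n => measureReal_mono fun ω hω => ?_)
      (hneg ε hε)
    have hω : ε ≤ ‖(W - empVector P X (rakedScore P A B N)) n ω - 0‖ := by simpa using hω
    refine hω.trans ?_
    rw [sub_zero]
    refine (norm_le_sum_abs _).trans (le_trans (le_of_eq ?_) (le_abs_self _))
    refine Finset.sum_congr rfl fun i _ => ?_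
    congr 1
    have hemp : ∀ (c : ℝ) (f : 𝒳 → ℝ), empirical (fun i => X i ω) n (c • f) =
        c * empirical (fun i => X i ω) n f := fun c f => by
      simp [empirical, ← Finset.mul_sum, mul_div_assoc]
    have hint : ∀ (c : ℝ) (f : 𝒳 → ℝ), ∫ x, (c • f) x ∂P = c * ∫ x, f x ∂P := fun c f => by
      simp [integral_const_mul]
    simp only [Pi.sub_apply, PiLp.sub_apply, hW, chiVector, empVector, rakedScore, hemp, hint]
    rw [integral_indicator_one (hB.measurableSet i)]
    ring
  have hlim := tendstoInDistribution_of_tendstoInMeasure_sub W id hclt hdiff hWm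
  have := tendsto_measureReal_lt_norm_sq
    (posSemidef_covMatrix fun i => (hscore i).memLp P 2) hlim hc
  simpa only [hW, norm_chiVector_sq hH] using this

/-- Without raking, the limiting quadratic form is the squared distance to a line. -/
lemma dotProduct_covMatrix_rakedScore_zero (hB : IsMeasurablePartition B)
    (hpos : ∀ i, 0 < P.real (B i)) (x : EuclideanSpace ℝ (Fin m)) :
    x.ofLp ⬝ᵥ (covMatrix P (rakedScore P A B 0)).mulVec x.ofLp =
      ‖x‖ ^ 2 - inner ℝ (WithLp.toLp 2 fun i => √(P.real (B i))) x ^ 2 := by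
  have hb := fun i => IsBddMeasurable.indicator_one (hB.measurableSet i)
  have hcov : ∀ i j, cov[(B i).indicator (1 : 𝒳 → ℝ), (B j).indicator (1 : 𝒳 → ℝ); P] =
      (if i = j then P.real (B i) else 0) - P.real (B i) * P.real (B j) := by
    intro i j
    rw [covariance_eq_sub ((hb i).memLp P 2) ((hb j).memLp P 2),
      integral_indicator_one (hB.measurableSet i), integral_indicator_one (hB.measurableSet j)]
    congr 1
    rw [← Set.inter_indicator_one,
      integral_indicator_one ((hB.measurableSet i).inter (hB.measurableSet j))]
    split_ifs with h
    · rw [h, Set.inter_self]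
    · rw [(hB.pairwise_disjoint h).inter_eq, measureReal_empty]
  have hs : ∀ i, 0 < √(P.real (B i)) := fun i => Real.sqrt_pos.2 (hpos i)
  have hsq : ∀ i, √(P.real (B i)) * √(P.real (B i)) = P.real (B i) := fun i =>
    Real.mul_self_sqrt measureReal_nonneg
  -- The matrix is I - uuᵀ with uᵢ = √P(Bᵢ).
  have hentry : ∀ i j, covMatrix P (rakedScore P A B 0) i j =
      (if i = j then 1 else 0) - √(P.real (B i)) * √(P.real (B j)) := by
    intro i j
    simp only [covMatrix, Matrix.of_apply, rakedScore, iterCentered, covariance_smul_left,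
      covariance_smul_right, hcov]
    split_ifs with h
    · subst h
      have := hs i
      nth_rewrite 3 4 5 [← hsq i]
      field_simp
    · have := hs i
      have := hs j
      rw [← hsq i, ← hsq j]
      simp only [Real.sqrt_mul_self (Real.sqrt_nonneg _)]
      field_simp
      ring
  simp only [dotProduct, Matrix.mulVec, hentry, sub_mul, Finset.sum_sub_distrib, ite_mul, one_mul,
    zero_mul, Finset.sum_ite_eq, Finset.mem_univ, if_true, mul_sub, EuclideanSpace.real_norm_sq_eq,
    PiLp.inner_apply, RCLike.inner_apply, conj_trivial]
  congr 1
  · exact Finset.sum_congr rfl fun i _ => by ring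
  · rw [sq, Finset.sum_mul_sum]
    refine Finset.sum_congr rfl fun i _ => ?_
    rw [Finset.mul_sum]
    exact Finset.sum_congr rfl fun j _ => by ring

lemma stdGaussian_real_lt_rakedScore_zero (hm : 2 ≤ m) (hB : IsMeasurablePartition B)
    (hpos : ∀ i, 0 < P.real (B i)) {α : ℝ} (h0 : 0 < α) (h1 : α < 1) :
    (stdGaussian (EuclideanSpace ℝ (Fin m))).real
      {x | critical m α < x.ofLp ⬝ᵥ (covMatrix P (rakedScore P A B 0)).mulVec x.ofLp} = α := by
  simp_rw [dotProduct_covMatrix_rakedScore_zero hB hpos]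
  obtain ⟨d, rfl⟩ : ∃ d, m = d + 1 := ⟨m - 1, by omega⟩
  set u : EuclideanSpace ℝ (Fin (d + 1)) := WithLp.toLp 2 fun i => √(P.real (B i)) with hu
  have hu1 : ‖u‖ = 1 := by
    have : ‖u‖ ^ 2 = 1 := by
      rw [EuclideanSpace.real_norm_sq_eq, ← hB.sum_measureReal (P := P)]
      exact Finset.sum_congr rfl fun i _ => Real.sq_sqrt measureReal_nonneg
    nlinarith [norm_nonneg u]
  have hchi := chiSquare_Ioi_critical hm h0 h1
  rw [Nat.add_sub_cancel, ← map_norm_sq_sub_inner_sq u hu1,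
    map_measureReal_apply (by fun_prop) measurableSet_Ioi] at hchi
  exact hchi

/-- Raking decreases the limiting quadratic form. -/
lemma dotProduct_covMatrix_rakedScore_le (hB : IsMeasurablePartition B)
    (hA : ∀ k ∈ Set.Icc 1 N, IsMeasurablePartition (A k))
    (hA_pos : ∀ k ∈ Set.Icc 1 N, ∀ j, 0 < P.real (A k j)) (x : Fin m → ℝ) :
    x ⬝ᵥ (covMatrix P (rakedScore P A B N)).mulVec x ≤
      x ⬝ᵥ (covMatrix P (rakedScore P A B 0)).mulVec x := by
  have hb := fun i => IsBddMeasurable.indicator_one (hB.measurableSet i)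
  have hA0 : ∀ k ∈ Set.Icc 1 0, IsMeasurablePartition (A k) := fun k hk => by
    have := hk.1.trans hk.2
    omega
  rw [dotProduct_covMatrix_mulVec fun i => (isBddMeasurable_rakedScore hB hA i).memLp P 2,
    dotProduct_covMatrix_mulVec fun i => (isBddMeasurable_rakedScore hB hA0 i).memLp P 2]
  -- By linearity the combination of scores is the iterated centering of one function that does not
  -- depend on the number of steps.
  have hsum : ∀ M : ℕ, (∀ k ∈ Set.Icc 1 M, IsMeasurablePartition (A k)) →
      (fun y => ∑ i, x i * rakedScore P A B M i y) =
        iterCentered P A M (∑ i, (x i * (√(P.real (B i)))⁻¹) • (B i).indicator 1) := by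
    intro M hM
    rw [iterCentered_sum hM hb]
    ext y
    simp [rakedScore, mul_assoc]
  rw [hsum N hA, hsum 0 hA0]
  exact variance_iterCentered_le hA hA_pos (.sum fun i => (hb i).const_smul _)

lemma stdGaussian_real_lt_rakedScore_le (hm : 2 ≤ m) (hB : IsMeasurablePartition B)
    (hpos : ∀ i, 0 < P.real (B i)) (hA : ∀ k ∈ Set.Icc 1 N, IsMeasurablePartition (A k))
    (hA_pos : ∀ k ∈ Set.Icc 1 N, ∀ j, 0 < P.real (A k j)) {α : ℝ} (h0 : 0 < α) (h1 : α < 1) :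
    (stdGaussian (EuclideanSpace ℝ (Fin m))).real
      {x | critical m α < x.ofLp ⬝ᵥ (covMatrix P (rakedScore P A B N)).mulVec x.ofLp} ≤ α := by
  refine le_trans (measureReal_mono fun x hx => ?_)
    (stdGaussian_real_lt_rakedScore_zero (A := A) hm hB hpos h0 h1).le
  exact lt_of_lt_of_le hx (dotProduct_covMatrix_rakedScore_le hB hA hA_pos x.ofLp)

end ChiStat

end RakingRatio

end

/-! ### The proposition -/

open RakingRatio in
theorem proposition3 {Ω 𝒳 : Type*} [MeasurableSpace Ω] [MeasurableSpace 𝒳]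
    (μ : Measure Ω) [IsProbabilityMeasure μ]
    (P P₀ : Measure 𝒳) [IsProbabilityMeasure P] [IsProbabilityMeasure P₀]
    -- the i.i.d. sample with law `P`
    (X : ℕ → Ω → 𝒳) (hX_indep : iIndepFun X μ) (hX_law : ∀ i, HasLaw (X i) P μ)
    -- the partition on which the test is performed
    (m : ℕ) (hm : 2 ≤ m) (B : Fin m → Set 𝒳) (hB : IsMeasurablePartition B)
    (hB_pos : ∀ i, 0 < P₀.real (B i))
    -- the auxiliary partitions
    (N : ℕ) (mA : ℕ → ℕ) (A : (k : ℕ) → Fin (mA k) → Set 𝒳)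
    (hA : ∀ k ∈ Set.Icc 1 N, IsMeasurablePartition (A k))
    (hA_pos : ∀ k ∈ Set.Icc 1 N, ∀ j, 0 < P.real (A k j))
    -- the sizes of the sources of information and the learned probabilities,
    -- with no assumption on their joint law with each other and with the sample
    (size : ℕ → ℕ → ℕ) (hsize : ∀ k ∈ Set.Icc 1 N, ∀ n, 1 ≤ n → n < size k n)
    (learned : (k : ℕ) → ℕ → Ω → Fin (mA k) → ℝ)
    (hlearned : ∀ k ∈ Set.Icc 1 N, ∀ n, 1 ≤ n →
      HasLaw (learned k n) (multinomialFreq (size k n) fun j => P.real (A k j)) μ) :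
    -- under the null hypothesis
    ((∀ i, P.real (B i) = P₀.real (B i)) → ∀ α : ℝ, 0 < α → α < 1 →
      (Tendsto (fun n => μ.real {ω | critical m α < stat B P₀ X n ω}) atTop (𝓝 α) ∧
        ∃ ℓ : ℝ,
          Tendsto (fun n => μ.real {ω | critical m α < statTrue B P₀ P A X N n ω})
            atTop (𝓝 ℓ) ∧
          ℓ ≤ α) ∧
      ((fun n : ℕ => (n : ℝ) * Real.log n) =o[atTop] (fun n => (minSize size N n : ℝ)) →
        ∃ ℓ : ℝ,
          Tendsto (fun n => μ.real {ω | critical m α < statLearned B P₀ A learned X N n ω})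
            atTop (𝓝 ℓ) ∧
          ℓ ≤ α)) ∧
    -- under the alternative hypothesis
    ((¬ ∀ i, P.real (B i) = P₀.real (B i)) → ∀ α : ℝ, 0 < α → α < 1 →
      ∀ᵐ ω ∂μ, ∃ n₀ : ℕ, ∀ n > n₀,
        critical m α <
          min |stat B P₀ X n ω|
            (min |statTrue B P₀ P A X N n ω| |statLearned B P₀ A learned X N n ω|)) := by
  have hA_cell : ∀ k ∈ Set.Icc 1 N, ∀ j, ∀ n, 1 ≤ n →
      AEMeasurable (fun ω => learned k n ω j) μ := fun k hk j n hn =>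
    (measurable_pi_apply j).comp_aemeasurable (hlearned k hk n hn).aemeasurable
  have hraked0 : ∀ (p : (k : ℕ) → Fin (mA k) → ℝ) (x : ℕ → 𝒳) (n : ℕ),
      raked A p x n 0 = empirical x n := fun p x n => by
    ext f
    simp only [raked]
  have hempty : ∀ {p : ℕ → Prop}, ∀ k ∈ Set.Icc 1 0, p k := fun k hk => by
    have := hk.1.trans hk.2
    omega
  constructor
  · intro hH α hα0 hα1
    have hpos : ∀ i, 0 < P.real (B i) := fun i => by rw [hH]; exact hB_pos i
    have hc := critical_pos hm hα1 hα0
    have hle := stdGaussian_real_lt_rakedScore_le hm hB hpos hA hA_pos hα0 hα1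
    refine ⟨⟨?_, _, ?_, hle⟩, fun hlog => ⟨_, ?_, hle⟩⟩
    -- The unraked statistic is the case of zero steps, where the choice of weights is immaterial
    -- and the conditions on them are vacuous.
    · have h := tendsto_measureReal_lt_chiStat_raked (A := A) (N := 0) (w := learned)
        hX_indep hX_law hB hH hempty hempty hempty hempty hc
      rw [stdGaussian_real_lt_rakedScore_zero hm hB hpos hα0 hα1] at h
      simpa only [hraked0, stat] using h
    -- True probabilities are constant weights with zero error.
    · exact tendsto_measureReal_lt_chiStat_raked (w := fun k _ _ j => P.real (A k j))
        hX_indep hX_law hB hH hA hA_pos (fun _ _ _ _ _ => aemeasurable_const)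
        (fun k _ j => by simpa only [sub_self, mul_zero] using isNegligible_zero) hc
    · exact tendsto_measureReal_lt_chiStat_raked hX_indep hX_law hB hH hA hA_pos
        (fun k hk n hn j => hA_cell k hk j n hn)
        (fun k hk j => isNegligible_learned (hA k hk) (hsize k hk) (hlearned k hk)
          (tendsto_size_div_atTop hlog hk) j) hc
  · intro hH α _ _
    obtain ⟨i, hi⟩ := not_forall.1 hH
    have hind : IsBddMeasurable ((B i).indicator (1 : 𝒳 → ℝ)) :=
      .indicator_one (hB.measurableSet i)
    have h0 := ae_tendsto_raked (A := A) (w := learned) (N := 0) hX_indep hX_law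
      hempty hempty hempty hind
    have h1 := ae_tendsto_raked (w := fun k _ _ j => P.real (A k j)) hX_indep hX_law hA hA_pos
      (fun _ _ _ => ae_of_all _ fun _ => tendsto_const_nhds) hind
    have h2 := ae_tendsto_raked hX_indep hX_law hA hA_pos
      (fun k hk j => ae_tendsto_learned (hA k hk) (hsize k hk) (hlearned k hk) j) hind
    filter_upwards [h0, h1, h2] with ω h0 h1 h2
    rw [integral_indicator_one (hB.measurableSet i)] at h0 h1 h2
    simp only [hraked0] at h0
    have hall := ((eventually_lt_abs_chiStat hB_pos hi h0 (critical m α)).and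
      ((eventually_lt_abs_chiStat hB_pos hi h1 (critical m α)).and
        (eventually_lt_abs_chiStat hB_pos hi h2 (critical m α))))
    obtain ⟨n₀, hn₀⟩ := eventually_atTop.1 hall
    refine ⟨n₀, fun n hn => ?_⟩
    obtain ⟨e0, e1, e2⟩ := hn₀ n hn.le
    exact lt_min e0 (lt_min e1 e2)
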